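/- Let $p$ be an odd prime, let $\lambda\in\mathbb{P}^1(\mathbb{C})\setminus\{0,1,\infty\}$, and let $X_{p,\lambda}$ be the smooth projective curve $$(x_2^p-x_1^p)(y_2^p-y_1^p)=\lambda x_1^p y_1^p$$ in $\mathbb{P}^1\times\mathbb{P}^1=\{([x_1:x_2],[y_1:y_2])\}$ over $\mathbb{C}$, with affine coordinates $x=x_1/x_2$, $y=y_1/y_2$. A cusp of $X_{p,\lambda}$ is a point with $x_1x_2y_1y_2=0$. Let $\rho\in\mathbb{C}$ with $\rho^p=1-\lambda$, let $\xi\in\mathbb{C}$ with $\xi^2=\rho^{-1}$, and let $P=(\xi,-\xi)$ and $Q=(-\xi,\xi)$ in the affine coordinates $(x,y)$; these are points of $X_{p,\lambda}$ (the fixed points of the involution $(x,y)\mapsto(1/(\rho x),1/(\rho y))$). For $1\le a,b\le p-1$ let $C^{a,b}_{p,\lambda}$ be the smooth projective curve over $\mathbb{C}$ with affine equation $$v^p=(-u)^a(1-u)^{p-a}(1-\lambda u)^{p-b},$$ and let $\varphi^{a,b}_p\colon X_{p,\lambda}\to C^{a,b}_{p,\lambda}$ be the finite morphism given by $$(u,v)=\left(-\frac{x^p}{1-x^p},\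 \frac{x^ay^b}{(1-x^p)y^p}\right).$$ If $(a,b)=(1,1)$ or $(a,b)=(1,p-1)$, then for every cusp $e\in X_{p,\lambda}$ the point $$(\varphi^{a,b}_p)_*([P]+[Q]-2[e])\in\operatorname{Jac}(C^{a,b}_{p,\lambda}),$$ i.e. the class of the degree-zero divisor $[\varphi^{a,b}_p(P)]+[\varphi^{a,b}_p(Q)]-2[\varphi^{a,b}_p(e)]$, is torsion. -/

import Mathlib

open Polynomial

namespace HypergeometricCurve

noncomputable section

/-- The parameter space `P¹ ∖ {0, 1, ∞}` of `λ` (in Lean `l`). -/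
abbrev Parameter : Type := {l : ℂ // l ≠ 0 ∧ l ≠ 1}
/-- The exponents `1 ≤ a ≤ p - 1`. -/
abbrev Exponent (p : ℕ) : Type := {a : ℕ // 0 < a ∧ a < p}

/-! ### The function fields of the two curves -/

theorem ratFunc_pow_ne {p : ℕ} (c : ℂ) {n d : ℂ[X]} (hn : n ≠ 0) (hd : d ≠ 0)
    (h0 : 0 < n.rootMultiplicity c) (h1 : n.rootMultiplicity c < p)
    (h2 : d.rootMultiplicity c = 0) (h : RatFunc ℂ) :
    h ^ p ≠ algebraMap ℂ[X] (RatFunc ℂ) n / algebraMap ℂ[X] (RatFunc ℂ) d := by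
  intro H
  have hd' : algebraMap ℂ[X] (RatFunc ℂ) d ≠ 0 := RatFunc.algebraMap_ne_zero hd
  have hden : algebraMap ℂ[X] (RatFunc ℂ) h.denom ≠ 0 :=
    RatFunc.algebraMap_ne_zero h.denom_ne_zero
  rw [← RatFunc.num_div_denom h, div_pow, div_eq_div_iff (pow_ne_zero _ hden) hd',
    ← map_pow, ← map_pow, ← map_mul, ← map_mul] at H
  have H' : h.num ^ p * d = n * h.denom ^ p := RatFunc.algebraMap_injective ℂ H
  have hr : n * h.denom ^ p ≠ 0 := mul_ne_zero hn (pow_ne_zero _ h.denom_ne_zero)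
  have hl : h.num ^ p * d ≠ 0 := H' ▸ hr
  have := congrArg (rootMultiplicity c) H'
  rw [rootMultiplicity_mul hl, rootMultiplicity_mul hr, ← count_roots (h.num ^ p), roots_pow,
    ← count_roots (h.denom ^ p), roots_pow, Multiset.count_nsmul, Multiset.count_nsmul, h2] at this
  have hdvd : p ∣ n.rootMultiplicity c := by
    rw [add_zero] at this
    exact (Nat.dvd_add_left (Dvd.intro _ rfl)).1 ⟨_, this.symm⟩
  exact absurd (Nat.le_of_dvd h0 hdvd) (not_le.2 h1)

/-- The affine equation `(1 - x^N) (1 - y^N) - λ x^N y^N` of the hypergeometric curve `X_{N,λ}`,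
as a polynomial in `y` over `ℂ(x)`. -/
def curvePoly (N : ℕ) (l : ℂ) : (RatFunc ℂ)[X] :=
  C (1 - RatFunc.X ^ N) * (1 - X ^ N) - C (RatFunc.C l * RatFunc.X ^ N) * X ^ N

/-- The affine equation `v^N - (-u)^a (1 - u)^(N - a) (1 - λ u)^(N - b)` of `C^{a,b}_{N,λ}`,
as a polynomial in `v` over `ℂ(u)`. -/
def quotientPoly (N : ℕ) (l : ℂ) (a b : ℕ) : (RatFunc ℂ)[X] :=
  X ^ N - C ((-RatFunc.X) ^ a * (1 - RatFunc.X) ^ (N - a) *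
    (1 - RatFunc.C l * RatFunc.X) ^ (N - b))

instance curvePoly_irreducible (p : ℕ) [hp : Fact p.Prime] (l : Parameter) :
    Fact (Irreducible (curvePoly p l)) := by
  obtain ⟨l, hl0, hl1⟩ := l
  have hp0 : p ≠ 0 := hp.out.ne_zero
  set n : ℂ[X] := 1 - X ^ p with hn
  set d : ℂ[X] := 1 - X ^ p + C l * X ^ p with hd
  have hn0 : n ≠ 0 := by
    intro h
    have := congrArg (eval 0) h
    simp [hn, hp0] at this
  have hd1 : d.eval 1 ≠ 0 := by simp [hd, hl0]
  have hd0 : d ≠ 0 := by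
    intro h
    simp [h] at hd1
  have hnroot : n.IsRoot 1 := by simp [hn]
  have hnm : n.rootMultiplicity 1 = 1 := by
    apply le_antisymm
    · by_contra h
      push Not at h
      have := (one_lt_rootMultiplicity_iff_isRoot hn0).1 h
      have h2 := this.2
      simp [hn, derivative_X_pow, hp0] at h2
    · exact (rootMultiplicity_pos hn0).2 hnroot
  have hdm : d.rootMultiplicity 1 = 0 := rootMultiplicity_eq_zero hd1
  have key := fun h : RatFunc ℂ => ratFunc_pow_ne (p := p) 1 hn0 hd0 (by omega)
    (by rw [hnm]; exact hp.out.one_lt) hdm h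
  have hirr := X_pow_sub_C_irreducible_of_prime hp.out key
  have hd' : algebraMap ℂ[X] (RatFunc ℂ) d ≠ 0 := RatFunc.algebraMap_ne_zero hd0
  have heq : curvePoly p l = C (-algebraMap ℂ[X] (RatFunc ℂ) d) *
      (X ^ p - C (algebraMap ℂ[X] (RatFunc ℂ) n / algebraMap ℂ[X] (RatFunc ℂ) d)) := by
    rw [mul_sub, ← C_mul, neg_mul, mul_div_cancel₀ _ hd']
    simp only [curvePoly, hn, hd, map_add, map_sub, map_one, map_pow, map_mul, map_neg,
      RatFunc.algebraMap_X, RatFunc.algebraMap_C]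
    ring
  refine ⟨?_⟩
  change Irreducible (curvePoly p l)
  rw [heq]
  rw [irreducible_isUnit_mul (isUnit_C.2 (neg_ne_zero.2 hd').isUnit)]
  exact hirr

instance quotientPoly_irreducible (p : ℕ) [hp : Fact p.Prime] (l : Parameter) (a b : Exponent p) :
    Fact (Irreducible (quotientPoly p l a b)) := by
  obtain ⟨a, ha0, hap⟩ := a
  set m : ℂ[X] := (-1) ^ a * (1 - X) ^ (p - a) * (1 - C (l : ℂ) * X) ^ (p - (b : ℕ)) with hm
  have hm0 : m.eval 0 ≠ 0 := by simp [hm]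
  have hmne : m ≠ 0 := by
    intro h
    simp [h] at hm0
  have hne : X ^ a * m ≠ 0 := mul_ne_zero (pow_ne_zero _ X_ne_zero) hmne
  have hmult : (X ^ a * m).rootMultiplicity 0 = a := by
    rw [rootMultiplicity_mul hne, rootMultiplicity_eq_zero hm0, add_zero]
    simpa using rootMultiplicity_X_sub_C_pow (0 : ℂ) a
  have key := fun h : RatFunc ℂ => ratFunc_pow_ne (p := p) (d := 1) 0 hne one_ne_zero
    (by omega) (by omega) (rootMultiplicity_eq_zero (by simp)) h
  have hirr := X_pow_sub_C_irreducible_of_prime hp.out key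
  refine ⟨?_⟩
  convert hirr using 2
  rw [quotientPoly]
  congr 2
  simp only [hm, map_one, div_one, map_mul, map_pow, map_sub, map_neg, RatFunc.algebraMap_X,
    RatFunc.algebraMap_C]
  rw [neg_pow RatFunc.X a]
  ring

/-- The function field `ℂ(x)(y)` of `X_{p,λ}`. -/
abbrev CurveField (p : ℕ) [Fact p.Prime] (l : Parameter) : Type :=
  AdjoinRoot (curvePoly p l)
/-- The function field `ℂ(u)(v)` of `C^{a,b}_{p,λ}`. -/
abbrev QuotientField (p : ℕ) [Fact p.Prime] (l : Parameter) (a b : Exponent p) : Type :=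
  AdjoinRoot (quotientPoly p l a b)


theorem aeval_injective {F : Type} [Field F] [Algebra ℂ F] {z : F}
    (hz : z ∉ Set.range (algebraMap ℂ F)) :
    Function.Injective (aeval z : ℂ[X] →ₐ[ℂ] F) := by
  rw [← transcendental_iff_injective]
  intro h
  apply hz
  have hi : IsIntegral ℂ z := h.isIntegral
  exact minpoly.mem_range_of_degree_eq_one ℂ z
    (IsAlgClosed.degree_eq_one_of_irreducible ℂ (minpoly.irreducible hi))

theorem pow_not_mem_range {F : Type} [Field F] [Algebra ℂ F] {z : F}
    (hz : z ∉ Set.range (algebraMap ℂ F)) {n : ℕ} (hn : n ≠ 0) :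
    z ^ n ∉ Set.range (algebraMap ℂ F) := by
  rintro ⟨c, hc⟩
  have h : aeval z (X ^ n - C c : ℂ[X]) = aeval z (0 : ℂ[X]) := by simp [hc]
  exact X_pow_sub_C_ne_zero (Nat.pos_of_ne_zero hn) c (aeval_injective hz h)

/-- The evaluation `f ↦ f(z)` of rational functions at a nonconstant element `z`. -/
def evalHom {F : Type} [Field F] [Algebra ℂ F] (z : F)
    (hz : z ∉ Set.range (algebraMap ℂ F)) : RatFunc ℂ →ₐ[ℂ] F :=
  RatFunc.liftAlgHom (aeval z)
    (nonZeroDivisors_le_comap_nonZeroDivisors_of_injective _ (aeval_injective hz))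

theorem evalHom_X {F : Type} [Field F] [Algebra ℂ F] (z : F)
    (hz : z ∉ Set.range (algebraMap ℂ F)) : evalHom z hz RatFunc.X = z := by
  have := RatFunc.liftAlgHom_apply_div (aeval z : ℂ[X] →ₐ[ℂ] F)
    (nonZeroDivisors_le_comap_nonZeroDivisors_of_injective _ (aeval_injective hz)) X 1
  simpa [evalHom] using this

theorem evalHom_C {F : Type} [Field F] [Algebra ℂ F] (z : F)
    (hz : z ∉ Set.range (algebraMap ℂ F)) (c : ℂ) :
    evalHom z hz (RatFunc.C c) = algebraMap ℂ F c := by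
  rw [← RatFunc.algebraMap_eq_C, AlgHom.commutes]

theorem eval₂_curvePoly {F : Type} [Field F] (N : ℕ) (l : ℂ) (i : RatFunc ℂ →+* F) (y : F) :
    (curvePoly N l).eval₂ i y = (1 - i RatFunc.X ^ N) * (1 - y ^ N) -
      i (RatFunc.C l) * i RatFunc.X ^ N * y ^ N := by
  simp only [curvePoly, eval₂_sub, eval₂_mul, eval₂_C, eval₂_one, eval₂_pow, eval₂_X]
  simp only [map_sub, map_mul, map_one, map_pow]

/-- A pair `(x, y)` of elements of an extension field of `ℂ`, with `x` nonconstant and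
`(1 - x^p)(1 - y^p) = λ x^p y^p`, determines an embedding of the function field. -/
def CurveField.lift (p : ℕ) [Fact p.Prime] (l : Parameter) {F : Type} [Field F] [Algebra ℂ F]
    (x y : F) (hx : x ∉ Set.range (algebraMap ℂ F))
    (h : (1 - x ^ p) * (1 - y ^ p) = algebraMap ℂ F l * x ^ p * y ^ p) :
    CurveField p l →ₐ[ℂ] F :=
  AdjoinRoot.liftAlgHom _ (evalHom x hx) y (by
    rw [eval₂_curvePoly]
    simp only [RingHom.coe_coe, evalHom_X, evalHom_C]
    exact sub_eq_zero.2 h)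

/-- The coordinate function `x = x₁ / x₂` on `X_{p,λ}`. -/
def CurveField.x (p : ℕ) [Fact p.Prime] (l : Parameter) : CurveField p l :=
  AdjoinRoot.of _ RatFunc.X

/-- The coordinate function `y = y₁ / y₂` on `X_{p,λ}`. -/
def CurveField.y (p : ℕ) [Fact p.Prime] (l : Parameter) : CurveField p l :=
  AdjoinRoot.root _

theorem CurveField.lift_x (p : ℕ) [Fact p.Prime] (l : Parameter) {F : Type} [Field F] [Algebra ℂ F]
    (x y : F) (hx : x ∉ Set.range (algebraMap ℂ F))
    (h : (1 - x ^ p) * (1 - y ^ p) = algebraMap ℂ F l * x ^ p * y ^ p) :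
    CurveField.lift p l x y hx h (CurveField.x p l) = x := by
  simp [CurveField.lift, CurveField.x, evalHom_X]

theorem CurveField.lift_y (p : ℕ) [Fact p.Prime] (l : Parameter) {F : Type} [Field F] [Algebra ℂ F]
    (x y : F) (hx : x ∉ Set.range (algebraMap ℂ F))
    (h : (1 - x ^ p) * (1 - y ^ p) = algebraMap ℂ F l * x ^ p * y ^ p) :
    CurveField.lift p l x y hx h (CurveField.y p l) = y := by
  simp [CurveField.lift, CurveField.y]

theorem CurveField.equation (p : ℕ) [Fact p.Prime] (l : Parameter) :
    (1 - x p l ^ p) * (1 - y p l ^ p) =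
      algebraMap ℂ (CurveField p l) l * x p l ^ p * y p l ^ p := by
  have h := AdjoinRoot.eval₂_root (curvePoly p l)
  rw [eval₂_curvePoly] at h
  exact sub_eq_zero.1 h

theorem CurveField.x_not_mem_range (p : ℕ) [Fact p.Prime] (l : Parameter) :
    CurveField.x p l ∉ Set.range (algebraMap ℂ (CurveField p l)) := by
  rintro ⟨c, hc⟩
  have h : AdjoinRoot.of (curvePoly p l) (RatFunc.C c) = AdjoinRoot.of _ RatFunc.X := hc
  have h1 := (AdjoinRoot.of (curvePoly p l)).injective h
  rw [← RatFunc.algebraMap_C, ← RatFunc.algebraMap_X] at h1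
  exact X_ne_C c (RatFunc.algebraMap_injective ℂ h1).symm

theorem one_sub_x_pow_ne_zero (p : ℕ) [hp : Fact p.Prime] (l : Parameter) :
    1 - CurveField.x p l ^ p ≠ 0 := fun h =>
  pow_not_mem_range (CurveField.x_not_mem_range p l) hp.out.ne_zero
    ⟨1, by rw [map_one]; exact sub_eq_zero.1 h⟩

theorem moebius_not_mem_range {F : Type} [Field F] [Algebra ℂ F] {z : F}
    (hz : z ∉ Set.range (algebraMap ℂ F)) :
    -z / (1 - z) ∉ Set.range (algebraMap ℂ F) := by
  have h1 : 1 - z ≠ 0 := fun h => hz ⟨1, by rw [map_one]; exact sub_eq_zero.1 h⟩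
  rintro ⟨c, hc⟩
  rw [eq_div_iff h1] at hc
  have h2 : (algebraMap ℂ F (c - 1)) * z = algebraMap ℂ F c := by
    rw [map_sub, map_one]; linear_combination -hc
  by_cases h3 : c = 1
  · simp [h3] at h2
  · apply hz
    refine ⟨c / (c - 1), ?_⟩
    have h4 : algebraMap ℂ F (c - 1) ≠ 0 := by
      rw [Ne, map_eq_zero]
      exact sub_ne_zero.2 h3
    rw [map_div₀, div_eq_iff h4, mul_comm, h2]

theorem phi_aux {F : Type} [Field F] {p a b : ℕ} (hp : p ≠ 0) (ha : a < p) (hb : b < p) {x y l : F}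
    (h1 : 1 - x ^ p ≠ 0) (h : (1 - x ^ p) * (1 - y ^ p) = l * x ^ p * y ^ p) :
    (x ^ a * y ^ b / ((1 - x ^ p) * y ^ p)) ^ p =
      (-(-x ^ p / (1 - x ^ p))) ^ a * (1 - -x ^ p / (1 - x ^ p)) ^ (p - a) *
        (1 - l * (-x ^ p / (1 - x ^ p))) ^ (p - b) := by
  have hy : y ≠ 0 := by
    rintro rfl
    simp [hp] at h
    exact h1 h
  have e1 : -(-x ^ p / (1 - x ^ p)) = x ^ p / (1 - x ^ p) := by ring
  have e2 : 1 - -x ^ p / (1 - x ^ p) = 1 / (1 - x ^ p) := by field_simp; ring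
  have e3 : 1 - l * (-x ^ p / (1 - x ^ p)) = 1 / y ^ p := by
    field_simp
    linear_combination -h
  rw [e1, e2, e3]
  have w1 : (1 - x ^ p) ^ p = (1 - x ^ p) ^ a * (1 - x ^ p) ^ (p - a) := by
    rw [← pow_add, Nat.add_sub_cancel' ha.le]
  have w2 : (y ^ p) ^ p = (y ^ b) ^ p * (y ^ p) ^ (p - b) := by
    rw [pow_right_comm y b p, ← pow_add, Nat.add_sub_cancel' hb.le]
  rw [div_pow, mul_pow, mul_pow, w1, w2, div_pow, div_pow, div_pow, one_pow, one_pow,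
    pow_right_comm x a p]
  field_simp

/-- The pull-back `φ^*` of functions along the finite morphism `φ : X_{p,λ} → C^{a,b}_{p,λ}`,
`(u, v) = (-x^p / (1 - x^p), x^a y^b / ((1 - x^p) y^p))`. -/
def pullback (p : ℕ) [hp : Fact p.Prime] (l : Parameter) (a b : Exponent p) :
    QuotientField p l a b →ₐ[ℂ] CurveField p l :=
  AdjoinRoot.liftAlgHom _
    (evalHom (-CurveField.x p l ^ p / (1 - CurveField.x p l ^ p)) (moebius_not_mem_range
      (pow_not_mem_range (CurveField.x_not_mem_range p l) hp.out.ne_zero)))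
    (CurveField.x p l ^ (a : ℕ) * CurveField.y p l ^ (b : ℕ) /
      ((1 - CurveField.x p l ^ p) * CurveField.y p l ^ p))
    (by
      have := phi_aux hp.out.ne_zero a.2.2 b.2.2 (one_sub_x_pow_ne_zero p l)
        (CurveField.equation p l)
      rw [quotientPoly, eval₂_sub, eval₂_pow, eval₂_X, eval₂_C]
      simp only [RingHom.coe_coe, map_mul, map_pow, map_neg, map_sub, map_one, evalHom_X,
        evalHom_C]
      exact sub_eq_zero.2 this)

/-- The coordinate function `u` on `C^{a,b}_{p,λ}`. -/
def QuotientField.u (p : ℕ) [Fact p.Prime] (l : Parameter) (a b : Exponent p) :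
    QuotientField p l a b :=
  AdjoinRoot.of _ RatFunc.X

/-- The coordinate function `v` on `C^{a,b}_{p,λ}`. -/
def QuotientField.v (p : ℕ) [Fact p.Prime] (l : Parameter) (a b : Exponent p) :
    QuotientField p l a b :=
  AdjoinRoot.root _

theorem pullback_u (p : ℕ) [Fact p.Prime] (l : Parameter) (a b : Exponent p) :
    pullback p l a b (QuotientField.u p l a b) =
      -CurveField.x p l ^ p / (1 - CurveField.x p l ^ p) := by
  simp [pullback, QuotientField.u, evalHom_X]

theorem pullback_v (p : ℕ) [Fact p.Prime] (l : Parameter) (a b : Exponent p) :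
    pullback p l a b (QuotientField.v p l a b) =
      CurveField.x p l ^ (a : ℕ) * CurveField.y p l ^ (b : ℕ) /
        ((1 - CurveField.x p l ^ p) * CurveField.y p l ^ p) := by
  simp [pullback, QuotientField.v]

/-! ### Points of smooth projective curves -/

/-- The points of the smooth projective curve over `ℂ` with function field `K`: the normalized
discrete valuations of `K` that are trivial on `ℂ`. For a point `v` and a function `f`, `v.ord f` is
the order of vanishing of `f` at `v`. -/
structure Place (K : Type) [Field K] [Algebra ℂ K] where
  ord : AddValuation K (WithTop ℤ)
  surjective : Function.Surjective ord
  ord_algebraMap : ∀ c : ℂ, c ≠ 0 → ord (algebraMap ℂ K c) = 0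

/-- The complex projective line. The homogeneous coordinates of a point `z = [z₁ : z₂]` are
`z₁ = z.rep 0` and `z₂ = z.rep 1`. -/
abbrev P1 : Type := Projectivization ℂ (Fin 2 → ℂ)

/-- The function `f` takes the value `[z₁ : z₂]`, that is `z₁ / z₂ ∈ ℂ ∪ {∞}`, at the valuation
`v`: if `f` is regular at `v` this says that `z₂ f - z₁` vanishes at `v`, and if `f` has a pole at
`v` it says that `z₂ = 0`. -/
def HasValueAt {K : Type} [Field K] [Algebra ℂ K] (v : AddValuation K (WithTop ℤ)) (f : K)
    (z₁ z₂ : ℂ) : Prop :=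
  min 0 (v f) < v (algebraMap ℂ K z₂ * f - algebraMap ℂ K z₁)

/-- The order of a Laurent series. -/
def seriesOrd : AddValuation (LaurentSeries ℂ) (WithTop ℤ) := HahnSeries.addVal ℤ ℂ

theorem algebraMap_laurent (c : ℂ) :
    algebraMap ℂ (LaurentSeries ℂ) c = HahnSeries.ofPowerSeries ℤ ℂ (PowerSeries.C c) := by
  rw [HahnSeries.algebraMap_apply', PowerSeries.algebraMap_apply]
  rfl

theorem seriesOrd_algebraMap {c : ℂ} (hc : c ≠ 0) :
    seriesOrd (algebraMap ℂ (LaurentSeries ℂ) c) = 0 := by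
  rw [algebraMap_laurent, HahnSeries.ofPowerSeries_C, seriesOrd, HahnSeries.addVal_apply]
  exact HahnSeries.orderTop_single hc

theorem seriesOrd_X :
    seriesOrd (HahnSeries.ofPowerSeries ℤ ℂ PowerSeries.X) = 1 := by
  rw [HahnSeries.ofPowerSeries_X, seriesOrd, HahnSeries.addVal_apply]
  exact HahnSeries.orderTop_single one_ne_zero

theorem seriesOrd_nonneg (f : PowerSeries ℂ) :
    0 ≤ seriesOrd (HahnSeries.ofPowerSeries ℤ ℂ f) := by
  rw [seriesOrd, HahnSeries.addVal_apply, HahnSeries.le_orderTop_iff_forall]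
  intro j hj
  have hj' : j < 0 := by exact_mod_cast hj
  rw [PowerSeries.coeff_coe, if_pos hj']

theorem seriesOrd_pos {f : PowerSeries ℂ} (hf : PowerSeries.constantCoeff f = 0) :
    0 < seriesOrd (HahnSeries.ofPowerSeries ℤ ℂ f) := by
  obtain ⟨g, rfl⟩ := PowerSeries.X_dvd_iff.2 hf
  rw [map_mul, AddValuation.map_mul, seriesOrd_X]
  exact lt_of_lt_of_le (by decide : (0 : WithTop ℤ) < 1) (le_add_of_nonneg_right (seriesOrd_nonneg g))

theorem exists_root_series {p : ℕ} (hp : p ≠ 0) {G : PowerSeries ℂ} {c : ℂ} (hc : c ≠ 0)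
    (h : PowerSeries.constantCoeff G = c ^ p) :
    ∃ Y : PowerSeries ℂ, Y ^ p = G ∧ PowerSeries.constantCoeff Y = c := by
  have hens := IsAdicComplete.henselianRing (PowerSeries ℂ)
    (Ideal.span {(PowerSeries.X : PowerSeries ℂ)})
  have hmem : ∀ f : PowerSeries ℂ, f ∈ Ideal.span {(PowerSeries.X : PowerSeries ℂ)} ↔
      PowerSeries.constantCoeff f = 0 := fun f => by
    rw [Ideal.mem_span_singleton, PowerSeries.X_dvd_iff]
  obtain ⟨Y, hY, hY'⟩ := hens.is_henselian (X ^ p - C G) (monic_X_pow_sub_C _ hp)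
    (PowerSeries.C c) (by
      rw [hmem]
      simp [h]) (by
      apply IsUnit.map
      rw [PowerSeries.isUnit_iff_constantCoeff]
      simp [derivative_X_pow, hc, hp])
  refine ⟨Y, ?_, ?_⟩
  · have := hY.eq_zero
    simpa [sub_eq_zero] using this
  · rw [hmem] at hY'
    simpa [sub_eq_zero] using hY'

/-- A local parametrization, by Laurent series in a local parameter, of `X_{p,λ}` at a point whose
second coordinate is neither `0` nor `∞`. -/
theorem exists_parametrization {p : ℕ} (hp : p ≠ 0) (l : Parameter) {x₁ x₂ y₁ y₂ : ℂ}
    (hx : x₁ ≠ 0 ∨ x₂ ≠ 0) (hy₁ : y₁ ≠ 0) (hy₂ : y₂ ≠ 0)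
    (h : (x₂ ^ p - x₁ ^ p) * (y₂ ^ p - y₁ ^ p) = l * x₁ ^ p * y₁ ^ p) :
    ∃ x y : LaurentSeries ℂ,
      (1 - x ^ p) * (1 - y ^ p) = algebraMap ℂ _ (l : ℂ) * x ^ p * y ^ p ∧
      HasValueAt seriesOrd x x₁ x₂ ∧ HasValueAt seriesOrd y y₁ y₂ ∧
      (seriesOrd x = (-1 : ℤ) ∨ ∃ c : ℂ, seriesOrd (x - algebraMap ℂ _ c) = 1) := by
  obtain ⟨l, hl0, hl1⟩ := l
  simp only at h ⊢
  have hvy : ∀ Y : PowerSeries ℂ, PowerSeries.constantCoeff Y = y₁ / y₂ →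
      HasValueAt seriesOrd (HahnSeries.ofPowerSeries ℤ ℂ Y) y₁ y₂ := by
    intro Y hY
    rw [HasValueAt, algebraMap_laurent, algebraMap_laurent, ← map_mul, ← map_sub,
      min_eq_left (seriesOrd_nonneg Y)]
    apply seriesOrd_pos
    simp [hY, mul_div_cancel₀ _ hy₂]
  have hy₂p : y₂ ^ p ≠ 0 := pow_ne_zero _ hy₂
  have hy₁p : y₁ ^ p ≠ 0 := pow_ne_zero _ hy₁
  by_cases hx₂ : x₂ = 0
  · subst hx₂
    have hx₁ : x₁ ≠ 0 := by simpa using hx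
    have hx₁p : x₁ ^ p ≠ 0 := pow_ne_zero _ hx₁
    set D : PowerSeries ℂ := PowerSeries.X ^ p - 1 + PowerSeries.C l with hD
    have hD0 : PowerSeries.constantCoeff D = l - 1 := by simp [hD, hp]; ring
    have hD1 : PowerSeries.constantCoeff D ≠ 0 := by rw [hD0]; exact sub_ne_zero.2 hl1
    obtain ⟨Y, hY, hY0⟩ := exists_root_series (G := (PowerSeries.X ^ p - 1) * D⁻¹) hp
      (div_ne_zero hy₁ hy₂) (by
        rw [map_mul, PowerSeries.constantCoeff_inv, hD0, div_pow, eq_div_iff hy₂p]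
        have : l - 1 ≠ 0 := sub_ne_zero.2 hl1
        simp [hp]
        field_simp
        rw [zero_pow hp] at h
        have h' : x₁ ^ p * (y₁ ^ p - y₂ ^ p) = x₁ ^ p * (l * y₁ ^ p) := by
          linear_combination h
        have h'' := mul_left_cancel₀ hx₁p h'
        linear_combination h'')
    have hYD : Y ^ p * D = PowerSeries.X ^ p - 1 := by
      rw [hY, mul_assoc, PowerSeries.inv_mul_cancel _ hD1, mul_one]
    set t : LaurentSeries ℂ := HahnSeries.ofPowerSeries ℤ ℂ PowerSeries.X with ht
    have ht0 : t ≠ 0 := by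
      intro h0
      have := seriesOrd_X
      rw [← ht, h0, AddValuation.map_zero] at this
      exact absurd this (by decide)
    have hordx : seriesOrd t⁻¹ = (-1 : ℤ) := by
      rw [AddValuation.map_inv, ht, seriesOrd_X]; rfl
    refine ⟨t⁻¹, HahnSeries.ofPowerSeries ℤ ℂ Y, ?_, ?_, hvy Y hY0, Or.inl hordx⟩
    · have e := congrArg (HahnSeries.ofPowerSeries ℤ ℂ) hYD
      rw [hD, map_mul, map_add, map_sub, map_one, map_pow, map_pow, ← algebraMap_laurent, ← ht] at e
      have htp : t ^ p ≠ 0 := pow_ne_zero _ ht0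
      rw [inv_pow]
      field_simp
      linear_combination -e
    · rw [HasValueAt, hordx, map_zero, zero_mul, zero_sub, AddValuation.map_neg,
        seriesOrd_algebraMap hx₁]
      decide
  · set c : ℂ := x₁ / x₂ with hc
    set d : ℂ := y₁ / y₂ with hd
    have h' : 1 - c ^ p = d ^ p * (1 - c ^ p + l * c ^ p) := by
      have hx₂p : x₂ ^ p ≠ 0 := pow_ne_zero _ hx₂
      rw [hc, hd, div_pow, div_pow]
      field_simp
      linear_combination h
    have hden : 1 - c ^ p + l * c ^ p ≠ 0 := by
      intro h0
      rw [h0, mul_zero] at h'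
      have h1 : c ^ p = 1 := (sub_eq_zero.1 h').symm
      rw [h1] at h0
      apply hl0
      linear_combination h0
    set xs : PowerSeries ℂ := PowerSeries.C c + PowerSeries.X with hxs
    set D : PowerSeries ℂ := 1 - xs ^ p + PowerSeries.C l * xs ^ p with hD
    have hD0 : PowerSeries.constantCoeff D = 1 - c ^ p + l * c ^ p := by simp [hD, hxs]
    have hD1 : PowerSeries.constantCoeff D ≠ 0 := by rw [hD0]; exact hden
    obtain ⟨Y, hY, hY0⟩ := exists_root_series (G := (1 - xs ^ p) * D⁻¹) hp
      (div_ne_zero hy₁ hy₂) (by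
        rw [map_mul, PowerSeries.constantCoeff_inv, hD0, ← hd]
        rw [mul_inv_eq_iff_eq_mul₀ hden, ← h']
        simp [hxs])
    have hYD : Y ^ p * D = 1 - xs ^ p := by
      rw [hY, mul_assoc, PowerSeries.inv_mul_cancel _ hD1, mul_one]
    refine ⟨HahnSeries.ofPowerSeries ℤ ℂ xs, HahnSeries.ofPowerSeries ℤ ℂ Y, ?_, ?_, hvy Y hY0,
      Or.inr ⟨c, ?_⟩⟩
    · have e := congrArg (HahnSeries.ofPowerSeries ℤ ℂ) hYD
      rw [hD, map_mul, map_add, map_sub, map_one, map_mul, map_pow, map_pow, ← algebraMap_laurent] at e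
      linear_combination -e
    · rw [HasValueAt, algebraMap_laurent, algebraMap_laurent, ← map_mul, ← map_sub,
        min_eq_left (seriesOrd_nonneg xs)]
      apply seriesOrd_pos
      simp [hxs, hc, mul_div_cancel₀ _ hx₂]
    · rw [algebraMap_laurent, ← map_sub, hxs, add_sub_cancel_left, seriesOrd_X]

theorem surjective_of_eq_one {K : Type} [Field K] (v : AddValuation K (WithTop ℤ)) {f : K}
    (hf : v f = 1) : Function.Surjective v := by
  have hpow : ∀ k : ℕ, v (f ^ k) = ((k : ℤ) : WithTop ℤ) := by
    intro k
    rw [AddValuation.map_pow, hf, nsmul_one]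
    rfl
  intro n
  induction n using WithTop.recTopCoe with
  | top => exact ⟨0, v.map_zero⟩
  | coe n =>
    obtain ⟨k, rfl | rfl⟩ := n.eq_nat_or_neg
    · exact ⟨_, hpow k⟩
    · exact ⟨(f ^ k)⁻¹, by rw [AddValuation.map_inv, hpow]; rfl⟩

theorem nsmul_coe (e : ℕ) (n : ℤ) : e • (n : WithTop ℤ) = ((e * n : ℤ) : WithTop ℤ) := by
  rw [← WithTop.coe_nsmul, nsmul_eq_mul]

theorem nsmul_top {e : ℕ} (he : 0 < e) : e • (⊤ : WithTop ℤ) = ⊤ := by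
  obtain ⟨k, rfl⟩ := Nat.exists_eq_add_of_lt he
  rw [zero_add, succ_nsmul, WithTop.add_top]

theorem nsmul_le_nsmul_iff {e : ℕ} (he : 0 < e) (a b : WithTop ℤ) : e • a ≤ e • b ↔ a ≤ b := by
  induction a using WithTop.recTopCoe with
  | top =>
    induction b using WithTop.recTopCoe with
    | top => simp
    | coe b =>
      rw [nsmul_top he, nsmul_coe, top_le_iff, top_le_iff]
      exact iff_of_false WithTop.coe_ne_top WithTop.coe_ne_top
  | coe a =>
    induction b using WithTop.recTopCoe with
    | top => simp [nsmul_top he]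
    | coe b =>
      rw [nsmul_coe, nsmul_coe, WithTop.coe_le_coe, WithTop.coe_le_coe]
      exact mul_le_mul_iff_right₀ (by exact_mod_cast he)

theorem nsmul_inj {e : ℕ} (he : 0 < e) {a b : WithTop ℤ} (h : e • a = e • b) : a = b :=
  le_antisymm ((nsmul_le_nsmul_iff he a b).1 h.le) ((nsmul_le_nsmul_iff he b a).1 h.ge)

/-- Let `i : K₀ → K` be the pull-back of functions along a finite morphism `g` of smooth projective
curves. The point `w` is the image `g v` of the point `v`: the valuation of `v` restricts to a
positive multiple (by the ramification index) of the valuation of `w`. -/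
def Place.LiesOver {K₀ K : Type} [Field K₀] [Algebra ℂ K₀] [Field K] [Algebra ℂ K]
    (i : K₀ →ₐ[ℂ] K) (v : Place K) (w : Place K₀) : Prop :=
  ∃ e : ℕ, 0 < e ∧ ∀ f : K₀, v.ord (i f) = e • w.ord f

/-- Points of the upper curve have images on the lower curve. -/
theorem Place.exists_below {K₀ K : Type} [Field K₀] [Algebra ℂ K₀] [Field K] [Algebra ℂ K]
    (i : K₀ →ₐ[ℂ] K) (v : Place K) (h : ∃ f : K₀, f ≠ 0 ∧ v.ord (i f) ≠ 0) :
    ∃ w : Place K₀, v.LiesOver i w := by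
  classical
  have hcoe : ∀ f : K₀, f ≠ 0 → ∃ n : ℤ, v.ord (i f) = n := by
    intro f hf
    have : v.ord (i f) ≠ ⊤ := by
      rw [AddValuation.ne_top_iff]
      exact (_root_.map_ne_zero i).2 hf
    exact (WithTop.ne_top_iff_exists.1 this).imp fun _ h => h.symm
  have hex : ∃ n : ℕ, 0 < n ∧ ∃ f : K₀, f ≠ 0 ∧ v.ord (i f) = (n : ℤ) := by
    obtain ⟨f, hf, hf'⟩ := h
    obtain ⟨n, hn⟩ := hcoe f hf
    have hn0 : n ≠ 0 := by
      rintro rfl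
      exact hf' hn
    refine ⟨n.natAbs, Int.natAbs_pos.2 hn0, ?_⟩
    rcases le_total 0 n with hs | hs
    · exact ⟨f, hf, by rw [Int.natAbs_of_nonneg hs, hn]⟩
    · exact ⟨f⁻¹, inv_ne_zero hf, by
        rw [map_inv₀, AddValuation.map_inv, hn, Int.ofNat_natAbs_of_nonpos hs]; rfl⟩
  set e := Nat.find hex with he
  obtain ⟨he0, g, hg, hgv⟩ := Nat.find_spec hex
  rw [← he] at he0 hgv
  have hzpow : ∀ k : ℤ, v.ord (i (g ^ k)) = ((e * k : ℤ) : WithTop ℤ) := by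
    intro k
    obtain ⟨m, rfl | rfl⟩ := k.eq_nat_or_neg
    · rw [zpow_natCast, map_pow, AddValuation.map_pow, hgv, nsmul_coe, mul_comm]
    · rw [zpow_neg, zpow_natCast, map_inv₀, map_pow, AddValuation.map_inv, AddValuation.map_pow,
        hgv, nsmul_coe, mul_neg, mul_comm]
      rfl
  have hdiv : ∀ f : K₀, ∃ k : WithTop ℤ, v.ord (i f) = e • k := by
    intro f
    by_cases hf : f = 0
    · exact ⟨⊤, by rw [hf, map_zero, AddValuation.map_zero, nsmul_top he0]⟩
    obtain ⟨n, hn⟩ := hcoe f hf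
    refine ⟨((n / e : ℤ) : WithTop ℤ), ?_⟩
    rw [nsmul_coe, hn]
    have he0' : (0 : ℤ) < e := by exact_mod_cast he0
    have hr : v.ord (i (f * g ^ (-(n / e : ℤ)))) = ((n % e : ℤ) : WithTop ℤ) := by
      rw [map_mul, AddValuation.map_mul, hn, hzpow, ← WithTop.coe_add, Int.emod_def]
      congr 1
      ring
    have hr0 : n % e = 0 := by
      by_contra hne
      have hpos : 0 < n % e := lt_of_le_of_ne (Int.emod_nonneg _ he0'.ne') (Ne.symm hne)
      have hlt := Int.emod_lt_of_pos n he0'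
      have hcast : (((n % e).toNat : ℕ) : ℤ) = n % e := Int.toNat_of_nonneg hpos.le
      refine Nat.find_min hex (m := (n % e).toNat) (by omega) ⟨by omega,
        f * g ^ (-(n / e : ℤ)), mul_ne_zero hf (zpow_ne_zero _ hg), ?_⟩
      rw [hcast]
      exact hr
    rw [Int.mul_ediv_cancel' (Int.dvd_of_emod_eq_zero hr0)]
  choose w hw using hdiv
  have hle := fun a b => nsmul_le_nsmul_iff he0 a b
  let W : AddValuation K₀ (WithTop ℤ) := AddValuation.of w
    (nsmul_inj he0 (by rw [← hw, nsmul_top he0, map_zero, AddValuation.map_zero]))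
    (nsmul_inj he0 (by rw [← hw, nsmul_zero, map_one, AddValuation.map_one]))
    (fun f f' => by
      rcases min_choice (w f) (w f') with hm | hm
      all_goals
        have h1 := min_le_left (w f) (w f')
        have h2 := min_le_right (w f) (w f')
        rw [hm] at h1 h2 ⊢
        rw [← hle] at h1 h2 ⊢
        simp only [← hw] at h1 h2 ⊢
        rw [map_add]
        exact AddValuation.map_le_add _ h1 h2)
    (fun f f' => nsmul_inj he0 (by
      rw [← hw, nsmul_add, ← hw, ← hw, map_mul, AddValuation.map_mul]))
  refine ⟨⟨W, surjective_of_eq_one W (f := g) ?_, ?_⟩, e, he0, hw⟩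
  · refine nsmul_inj he0 ?_
    change e • w g = _
    rw [← hw, hgv, nsmul_one]
    rfl
  · intro c hc
    refine nsmul_inj he0 ?_
    change e • w _ = _
    rw [← hw, AlgHom.commutes, v.ord_algebraMap c hc, nsmul_zero]

/-- The function `f` on a smooth projective curve takes the value `z ∈ P¹` at the point `v`. -/
def Place.HasValue {K : Type} [Field K] [Algebra ℂ K] (v : Place K) (f : K) (z : P1) : Prop :=
  HasValueAt v.ord f (z.rep 0) (z.rep 1)

/-- The hypergeometric curve `X_{N,λ}` in `P¹ × P¹`: the set of the points
`([x₁ : x₂], [y₁ : y₂])` with `(x₂^N - x₁^N) (y₂^N - y₁^N) = λ x₁^N y₁^N`. -/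
def Curve (N : ℕ) (l : Parameter) : Type :=
  {q : P1 × P1 // (q.1.rep 1 ^ N - q.1.rep 0 ^ N) * (q.2.rep 1 ^ N - q.2.rep 0 ^ N) =
    l * q.1.rep 0 ^ N * q.2.rep 0 ^ N}

/-- The valuation `v` of the function field of `X_{p,λ}` belongs to the point `q` of `X_{p,λ}`:
the coordinate functions `x` and `y` take at `v` the values given by `q`. Since `X_{p,λ}` is smooth,
exactly one `v` belongs to each `q`. -/
def Place.CenteredAt {p : ℕ} [Fact p.Prime] {l : Parameter} (v : Place (CurveField p l))
    (q : Curve p l) : Prop :=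
  v.HasValue (CurveField.x p l) q.1.1 ∧ v.HasValue (CurveField.y p l) q.1.2

theorem rep_ne (z : P1) : z.rep 0 ≠ 0 ∨ z.rep 1 ≠ 0 := by
  by_contra h
  push Not at h
  apply z.rep_nonzero
  ext i
  fin_cases i
  · exact h.1
  · exact h.2

theorem not_mem_range_of_ord {x : LaurentSeries ℂ}
    (h : seriesOrd x = (-1 : ℤ) ∨ ∃ c : ℂ, seriesOrd (x - algebraMap ℂ _ c) = 1) :
    x ∉ Set.range (algebraMap ℂ (LaurentSeries ℂ)) := by
  have key : ∀ (c : ℂ) (n : ℤ), n ≠ 0 → seriesOrd (algebraMap ℂ (LaurentSeries ℂ) c) ≠ n := by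
    intro c n hn h
    by_cases hc : c = 0
    · rw [hc, map_zero, AddValuation.map_zero] at h
      exact WithTop.top_ne_coe h
    · rw [seriesOrd_algebraMap hc] at h
      exact hn (by exact_mod_cast h.symm)
  rintro ⟨d, rfl⟩
  rcases h with h | ⟨c, h⟩
  · exact key d (-1) (by decide) h
  · rw [← map_sub] at h
    exact key (d - c) 1 (by decide) h

theorem not_mem_range_symm {F : Type} [Field F] [Algebra ℂ F] {p : ℕ} (hp : p ≠ 0) (l : Parameter)
    {x y : F} (h : (1 - x ^ p) * (1 - y ^ p) = algebraMap ℂ F l * x ^ p * y ^ p)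
    (hy : y ∉ Set.range (algebraMap ℂ F)) : x ∉ Set.range (algebraMap ℂ F) := by
  rintro ⟨c, rfl⟩
  have h' : y ^ p * algebraMap ℂ F (1 - c ^ p + l * c ^ p) = algebraMap ℂ F (1 - c ^ p) := by
    simp only [map_sub, map_add, map_mul, map_one, map_pow]
    linear_combination -h
  by_cases h0 : 1 - c ^ p + l * c ^ p = 0
  · rw [h0, map_zero, mul_zero, eq_comm, map_eq_zero] at h'
    have h1 : c ^ p = 1 := (sub_eq_zero.1 h').symm
    rw [h1] at h0
    exact l.2.1 (by linear_combination h0)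
  · apply pow_not_mem_range hy hp
    refine ⟨(1 - c ^ p) / (1 - c ^ p + l * c ^ p), ?_⟩
    rw [map_div₀, div_eq_iff ((_root_.map_ne_zero _).2 h0), h']

theorem exists_place_of_series (p : ℕ) [Fact p.Prime] (l : Parameter) {x y : LaurentSeries ℂ}
    (hx : x ∉ Set.range (algebraMap ℂ (LaurentSeries ℂ)))
    (h : (1 - x ^ p) * (1 - y ^ p) = algebraMap ℂ _ (l : ℂ) * x ^ p * y ^ p)
    (hz : ∃ z : LaurentSeries ℂ, (z = x ∨ z = y) ∧
      (seriesOrd z = (-1 : ℤ) ∨ ∃ c : ℂ, seriesOrd (z - algebraMap ℂ _ c) = 1)) :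
    ∃ v : Place (CurveField p l), ∀ f, v.ord f = seriesOrd (CurveField.lift p l x y hx h f) := by
  set i := CurveField.lift p l x y hx h
  have hmem : ∃ g, seriesOrd (i g) = 1 := by
    obtain ⟨z, hz, hord⟩ := hz
    have : ∃ g, i g = z := by
      rcases hz with rfl | rfl
      · exact ⟨_, CurveField.lift_x ..⟩
      · exact ⟨_, CurveField.lift_y ..⟩
    obtain ⟨g, rfl⟩ := this
    rcases hord with h1 | ⟨c, h1⟩
    · exact ⟨g⁻¹, by rw [map_inv₀, AddValuation.map_inv, h1]; rfl⟩
    · exact ⟨g - algebraMap ℂ _ c, by rw [map_sub, AlgHom.commutes, h1]⟩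
  obtain ⟨g, hg⟩ := hmem
  refine ⟨⟨seriesOrd.comap i.toRingHom, surjective_of_eq_one _ (f := g) hg, fun c hc => ?_⟩,
    fun f => rfl⟩
  change seriesOrd (i (algebraMap ℂ _ c)) = 0
  rw [AlgHom.commutes, seriesOrd_algebraMap hc]

theorem exists_place_centeredAt {p : ℕ} [hp : Fact p.Prime] {l : Parameter} (q : Curve p l) :
    ∃ v : Place (CurveField p l), v.CenteredAt q := by
  have hp0 := hp.out.ne_zero
  obtain ⟨⟨z, w⟩, hq⟩ := q
  simp only at hq
  suffices H : ∃ x y : LaurentSeries ℂ,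
      (1 - x ^ p) * (1 - y ^ p) = algebraMap ℂ _ (l : ℂ) * x ^ p * y ^ p ∧
      HasValueAt seriesOrd x (z.rep 0) (z.rep 1) ∧ HasValueAt seriesOrd y (w.rep 0) (w.rep 1) ∧
      x ∉ Set.range (algebraMap ℂ (LaurentSeries ℂ)) ∧
      ∃ t : LaurentSeries ℂ, (t = x ∨ t = y) ∧
        (seriesOrd t = (-1 : ℤ) ∨ ∃ c : ℂ, seriesOrd (t - algebraMap ℂ _ c) = 1) by
    obtain ⟨x, y, h, hvx, hvy, hx, ht⟩ := H
    obtain ⟨v, hv⟩ := exists_place_of_series p l hx h ht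
    refine ⟨v, ?_, ?_⟩
    · change HasValueAt _ _ _ _
      rw [HasValueAt, hv, hv, map_sub, map_mul, AlgHom.commutes, AlgHom.commutes,
        CurveField.lift_x]
      exact hvx
    · change HasValueAt _ _ _ _
      rw [HasValueAt, hv, hv, map_sub, map_mul, AlgHom.commutes, AlgHom.commutes,
        CurveField.lift_y]
      exact hvy
  by_cases hw : w.rep 0 ≠ 0 ∧ w.rep 1 ≠ 0
  · obtain ⟨x, y, h, hvx, hvy, ht⟩ := exists_parametrization hp0 l (rep_ne z) hw.1 hw.2 hq
    exact ⟨x, y, h, hvx, hvy, not_mem_range_of_ord ht, x, Or.inl rfl, ht⟩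
  · have hl := l.2.1
    have hl1 : (1 : ℂ) - l ≠ 0 := sub_ne_zero.2 (Ne.symm l.2.2)
    have hz : z.rep 0 ≠ 0 ∧ z.rep 1 ≠ 0 := by
      rcases rep_ne w with h0 | h1
      · have h1 : w.rep 1 = 0 := by tauto
        rw [h1, zero_pow hp0] at hq
        have h2 : w.rep 0 ^ p * z.rep 1 ^ p = w.rep 0 ^ p * ((1 - l) * z.rep 0 ^ p) := by
          linear_combination -hq
        have h3 := mul_left_cancel₀ (pow_ne_zero p h0) h2
        have := rep_ne z
        constructor
        · intro h4
          rw [h4, zero_pow hp0, mul_zero] at h3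
          have := pow_eq_zero_iff hp0 |>.1 h3
          tauto
        · intro h4
          rw [h4, zero_pow hp0, eq_comm, mul_eq_zero] at h3
          have := pow_eq_zero_iff hp0 |>.1 (h3.resolve_left hl1)
          tauto
      · have h0 : w.rep 0 = 0 := by tauto
        rw [h0, zero_pow hp0] at hq
        have h2 : w.rep 1 ^ p * z.rep 1 ^ p = w.rep 1 ^ p * z.rep 0 ^ p := by
          linear_combination hq
        have h3 := mul_left_cancel₀ (pow_ne_zero p h1) h2
        have := rep_ne z
        constructor
        · intro h4
          rw [h4, zero_pow hp0] at h3
          have := pow_eq_zero_iff hp0 |>.1 h3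
          tauto
        · intro h4
          rw [h4, zero_pow hp0, eq_comm] at h3
          have := pow_eq_zero_iff hp0 |>.1 h3
          tauto
    have hq' : (w.rep 1 ^ p - w.rep 0 ^ p) * (z.rep 1 ^ p - z.rep 0 ^ p) =
        l * w.rep 0 ^ p * z.rep 0 ^ p := by linear_combination hq
    obtain ⟨y, x, h, hvy, hvx, ht⟩ := exists_parametrization hp0 l (rep_ne w) hz.1 hz.2 hq'
    have h' : (1 - x ^ p) * (1 - y ^ p) = algebraMap ℂ _ (l : ℂ) * x ^ p * y ^ p := by
      linear_combination h
    exact ⟨x, y, h', hvx, hvy, not_mem_range_symm hp0 l h' (not_mem_range_of_ord ht), y,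
      Or.inr rfl, ht⟩

theorem exists_ord_pullback_ne_zero {p : ℕ} [hp : Fact p.Prime] {l : Parameter} (a b : Exponent p)
    (v : Place (CurveField p l)) {q : Curve p l} (h : v.CenteredAt q) :
    ∃ f : QuotientField p l a b, f ≠ 0 ∧ v.ord (pullback p l a b f) ≠ 0 := by
  have hp0 := hp.out.ne_zero
  have hx := CurveField.x_not_mem_range p l
  set x := CurveField.x p l
  suffices H : ∃ c : ℂ, v.ord (x ^ p - algebraMap ℂ _ c) ≠ 0 by
    obtain ⟨c, hc⟩ := H
    set u := QuotientField.u p l a b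
    have h1 : 1 - x ^ p ≠ 0 := one_sub_x_pow_ne_zero p l
    have himg : pullback p l a b (-u / (1 - u) - algebraMap ℂ _ c) =
        x ^ p - algebraMap ℂ _ c := by
      have hu : pullback p l a b u = -x ^ p / (1 - x ^ p) := pullback_u p l a b
      rw [map_sub, map_div₀, map_neg, map_sub, map_one, AlgHom.commutes, hu]
      congr 1
      have h2 : 1 - -x ^ p / (1 - x ^ p) = 1 / (1 - x ^ p) := by field_simp; ring
      rw [h2]
      field_simp
    refine ⟨_, ?_, himg ▸ hc⟩
    intro h0
    rw [h0, map_zero] at himg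
    exact pow_not_mem_range hx hp0 ⟨c, (sub_eq_zero.1 himg.symm).symm⟩
  have hval : HasValueAt v.ord x _ _ := h.1
  set z := q.1.1
  rw [HasValueAt] at hval
  by_cases hz : z.rep 1 = 0
  · have hz0 : z.rep 0 ≠ 0 := (rep_ne z).resolve_right (not_not.2 hz)
    rw [hz, map_zero, zero_mul, zero_sub, AddValuation.map_neg, v.ord_algebraMap _ hz0,
      min_lt_iff] at hval
    have hneg := hval.resolve_left (lt_irrefl _)
    refine ⟨0, ?_⟩
    rw [map_zero, sub_zero, AddValuation.map_pow]
    intro h0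
    exact hneg.ne (nsmul_inj (Nat.pos_of_ne_zero hp0) (h0.trans (nsmul_zero p).symm))
  · have hnn : 0 ≤ v.ord x := by
      by_contra hneg
      push Not at hneg
      rw [min_eq_right hneg.le] at hval
      have h2 : v.ord (algebraMap ℂ _ (z.rep 1) * x) = v.ord x := by
        rw [AddValuation.map_mul, v.ord_algebraMap _ hz, zero_add]
      have h3 : v.ord x < v.ord (algebraMap ℂ (CurveField p l) (z.rep 0)) := by
        refine lt_of_lt_of_le hneg ?_
        by_cases h0 : z.rep 0 = 0
        · rw [h0, map_zero, AddValuation.map_zero]; exact le_top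
        · rw [v.ord_algebraMap _ h0]
      rw [← h2] at h3
      have h4 := AddValuation.map_sub_eq_of_lt_left v.ord h3
      rw [h4, h2] at hval
      exact lt_irrefl _ hval
    rw [min_eq_left hnn] at hval
    have hc0 : ∀ c : ℂ, 0 ≤ v.ord (algebraMap ℂ (CurveField p l) c) := by
      intro c
      by_cases h0 : c = 0
      · rw [h0, map_zero, AddValuation.map_zero]; exact le_top
      · rw [v.ord_algebraMap _ h0]
    refine ⟨(z.rep 0 / z.rep 1) ^ p, ?_⟩
    have hz' : algebraMap ℂ (CurveField p l) (z.rep 1) ≠ 0 := (_root_.map_ne_zero _).2 hz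
    have e1 : v.ord (x - algebraMap ℂ _ (z.rep 0 / z.rep 1)) =
        v.ord (algebraMap ℂ (CurveField p l) (z.rep 1) * x - algebraMap ℂ _ (z.rep 0)) := by
      have : algebraMap ℂ (CurveField p l) (z.rep 1) * x - algebraMap ℂ _ (z.rep 0) =
          algebraMap ℂ (CurveField p l) (z.rep 1) *
            (x - algebraMap ℂ _ (z.rep 0 / z.rep 1)) := by
        rw [map_div₀]
        field_simp
      rw [this, AddValuation.map_mul, v.ord_algebraMap _ hz, zero_add]
    rw [← e1] at hval
    rw [map_pow, ← (Commute.all _ _).mul_geom_sum₂, AddValuation.map_mul]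
    refine (lt_of_lt_of_le hval (le_add_of_nonneg_right ?_)).ne'
    apply AddValuation.map_le_sum
    intro i _
    rw [AddValuation.map_mul, AddValuation.map_pow, AddValuation.map_pow]
    exact add_nonneg (nsmul_nonneg hnn _) (nsmul_nonneg (hc0 _) _)

/-- Each point of `X_{p,λ}` has an image on `C^{a,b}_{p,λ}`. -/
theorem exists_image {p : ℕ} [Fact p.Prime] {l : Parameter} (a b : Exponent p) (q : Curve p l) :
    ∃ w : Place (QuotientField p l a b), ∃ v : Place (CurveField p l),
      v.CenteredAt q ∧ v.LiesOver (pullback p l a b) w := by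
  obtain ⟨v, hv⟩ := exists_place_centeredAt q
  obtain ⟨w, hw⟩ := v.exists_below (pullback p l a b) (exists_ord_pullback_ne_zero a b v hv)
  exact ⟨w, v, hv, hw⟩

/-- The smooth projective curve `C^{a,b}_{p,λ}` (the set of its points). -/
abbrev QuotientCurve (p : ℕ) [Fact p.Prime] (l : Parameter) (a b : Exponent p) : Type :=
  Place (QuotientField p l a b)

/-- The morphism `φ^{a,b}_p : X_{p,λ} → C^{a,b}_{p,λ}` on points: `φ q` is the point of `C` that lies
below the point of the smooth projective model of `X` that belongs to `q`. -/
def phi (p : ℕ) [Fact p.Prime] (l : Parameter) (a b : Exponent p) (q : Curve p l) :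
    QuotientCurve p l a b :=
  (exists_image a b q).choose

/-! ### Divisors and Jacobians -/

/-- The group of divisors of degree zero on a curve with set of points `S`. -/
def DivZero (S : Type) : AddSubgroup (S →₀ ℤ) :=
  (Finsupp.degree : (S →₀ ℤ) →+ ℤ).ker

/-- The push-forward of divisors of degree zero, `∑ n_q [q] ↦ ∑ n_q [f q]`. -/
def pushforward {S T : Type} (f : S → T) : DivZero S →+ DivZero T :=
  ((Finsupp.mapDomain.addMonoidHom f).comp (DivZero S).subtype).codRestrict (DivZero T) (by
    rintro ⟨D, hD⟩
    have hD' : Finsupp.degree D = 0 := hD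
    change Finsupp.degree (Finsupp.mapDomain f D) = 0
    rw [Finsupp.degree_mapDomain, hD'])

/-- The group of the divisors `div f` of the functions `f ≠ 0` in `K`. -/
def principalDivisors (K : Type) [Field K] [Algebra ℂ K] : AddSubgroup (Place K →₀ ℤ) where
  carrier := {D | ∃ f : K, f ≠ 0 ∧ ∀ v : Place K, v.ord f = (D v : WithTop ℤ)}
  zero_mem' := ⟨1, one_ne_zero, fun v => by simp⟩
  add_mem' := by
    rintro D E ⟨f, hf, hD⟩ ⟨g, hg, hE⟩
    refine ⟨f * g, mul_ne_zero hf hg, fun v => ?_⟩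
    rw [AddValuation.map_mul, hD, hE]
    rfl
  neg_mem' := by
    rintro D ⟨f, hf, hD⟩
    refine ⟨f⁻¹, inv_ne_zero hf, fun v => ?_⟩
    rw [AddValuation.map_inv, hD]
    rfl

/-- The Jacobian (as a group) of the smooth projective curve with function field `K`: divisors of
degree zero modulo principal divisors. -/
abbrev Jacobian (K : Type) [Field K] [Algebra ℂ K] : Type :=
  DivZero (Place K) ⧸ (principalDivisors K).addSubgroupOf (DivZero (Place K))

/-- The divisor `[P] + [Q] - 2 [e]`. -/
def sumSubTwo {S : Type} (P Q e : S) : DivZero S :=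
  ⟨Finsupp.single P 1 + Finsupp.single Q 1 - 2 • Finsupp.single e 1, by
    change Finsupp.degree _ = 0
    simp⟩

/-! ### Cusps, and the points `P` and `Q` -/

/-- The cusps: the points with `x₁ x₂ y₁ y₂ = 0`. -/
def Curve.IsCusp {N : ℕ} {l : Parameter} (q : Curve N l) : Prop :=
  q.1.1.rep 0 * q.1.1.rep 1 * q.1.2.rep 0 * q.1.2.rep 1 = 0

/-- The point `[s : 1]` of `P¹`. -/
def affine (s : ℂ) : P1 := Projectivization.mk ℂ ![s, 1] (by
  intro h
  simpa using congrFun h 1)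

theorem affine_rep (s : ℂ) : ∃ c : ℂ, c ≠ 0 ∧ (affine s).rep 0 = c * s ∧ (affine s).rep 1 = c := by
  obtain ⟨c, hc⟩ := Projectivization.exists_smul_eq_mk_rep ℂ ![s, 1] (by
    intro h
    simpa using congrFun h 1)
  refine ⟨c, c.ne_zero, ?_, ?_⟩
  · have := congrFun hc 0
    rw [affine, ← this]
    simp [Units.smul_def]
  · have := congrFun hc 1
    rw [affine, ← this]
    simp [Units.smul_def]

/-- The point `([s : 1], [t : 1])` of `X_{N,λ}`. -/
def Curve.affinePoint {N : ℕ} {l : Parameter} (s t : ℂ)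
    (h : (1 - s ^ N) * (1 - t ^ N) = l * s ^ N * t ^ N) : Curve N l :=
  ⟨(affine s, affine t), by
    obtain ⟨c, _, h0, h1⟩ := affine_rep s
    obtain ⟨d, _, k0, k1⟩ := affine_rep t
    simp only [h0, h1, k0, k1, mul_pow]
    linear_combination c ^ N * d ^ N * h⟩

theorem fixedPoint_eq {N : ℕ} (hN : Odd N) {l : Parameter} {ρ ξ : ℂ}
    (hρ : ρ ^ N = 1 - l) (hξ : ξ ^ 2 = ρ⁻¹) :
    (1 - ξ ^ N) * (1 - (-ξ) ^ N) = l * ξ ^ N * (-ξ) ^ N := by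
  have hl : (1 : ℂ) - l ≠ 0 := sub_ne_zero.2 (Ne.symm l.2.2)
  have h1 : (ξ ^ N) ^ 2 * (1 - l) = 1 := by
    rw [pow_right_comm, hξ, inv_pow, hρ, inv_mul_cancel₀ hl]
  rw [hN.neg_pow]
  linear_combination -h1

/-- The point `P = (ξ, -ξ)`, where `ξ² = ρ⁻¹` and `ρ^N = 1 - λ` (`N` odd). -/
def Curve.fixedP {N : ℕ} (hN : Odd N) {l : Parameter} {ρ ξ : ℂ}
    (hρ : ρ ^ N = 1 - l) (hξ : ξ ^ 2 = ρ⁻¹) : Curve N l :=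
  .affinePoint ξ (-ξ) (fixedPoint_eq hN hρ hξ)

/-- The point `Q = (-ξ, ξ)`, where `ξ² = ρ⁻¹` and `ρ^N = 1 - λ` (`N` odd). -/
def Curve.fixedQ {N : ℕ} (hN : Odd N) {l : Parameter} {ρ ξ : ℂ}
    (hρ : ρ ^ N = 1 - l) (hξ : ξ ^ 2 = ρ⁻¹) : Curve N l :=
  .affinePoint (-ξ) ξ (by linear_combination fixedPoint_eq hN hρ hξ)

end
end HypergeometricCurve

/-! In both cases the curve $C$ is a double cover of the projective line. Put $w=(1-u)(1-\lambda
u)/v$ if $b=1$ and $w=(1-u)/v$ if $b=p-1$. Then $w^p$ is a rational function of degree two in $u$: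
respectively $-(1-u)(1-\lambda u)/u$ and $(u-1)/(u(1-\lambda u))$. Its zeros and poles are the four
points $0,1,1/\lambda,\infty$, over each of which $u$ is totally ramified. Cusps map to points over
these four values (`phi_isBranch`).

On $X$ the function $w$ becomes $1/(xy)$, respectively $y/x$, so it takes the same value $\omega$ at
$P$ and at $Q$. The images of $P$ and $Q$ form a whole fibre of $w$, because their $u$-coordinates
$r\ne s$ are the two roots of $\lambda z^2-2z+1$, the numerator of $w^p-\omega^p$. Let
$\gamma,\delta$ be the poles of $w^p$ and $\varepsilon$ the branch value at the cusp, all taken in a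
coordinate $U$ where they are finite. Then $(w-\omega)^p(U-\gamma)(U-\delta)/(U-\varepsilon)^2$ has
divisor $p([\varphi P]+[\varphi Q]-2[\varphi e])$, so the class is killed by $p$.

Points are valuations here, so a divisor computation must account for every valuation of the field.
`Place.eq_of_smooth` does this: at a smooth point of a plane model there is at most one valuation,
and a generator of the maximal ideal has order one there. `CyclicModel` treats both cases at once,
and `CyclicModel.nsmul_mem_principalDivisors` gives the divisor above. -/

namespace HypergeometricCurve

noncomputable section

/-! ### Orders and residues at a place; uniqueness of the place at a smooth point. -/

section Place

variable {K : Type} [Field K] [Algebra ℂ K]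

/-- The order of vanishing as an integer (with value `0` at the zero function). -/
def Place.order (v : Place K) (f : K) : ℤ := (v.ord f).untopD 0

theorem Place.coe_order (v : Place K) {f : K} (hf : f ≠ 0) : (v.order f : WithTop ℤ) = v.ord f := by
  have h : v.ord f ≠ ⊤ := (AddValuation.ne_top_iff _).2 hf
  obtain ⟨n, hn⟩ := WithTop.ne_top_iff_exists.1 h
  rw [Place.order, ← hn]
  rfl

theorem Place.order_eq_iff (v : Place K) {f : K} (hf : f ≠ 0) (n : ℤ) :
    v.order f = n ↔ v.ord f = n := by
  rw [← v.coe_order hf, WithTop.coe_inj]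

theorem Place.order_pos_iff (v : Place K) {f : K} (hf : f ≠ 0) :
    0 < v.order f ↔ 0 < v.ord f := by
  rw [← v.coe_order hf, ← WithTop.coe_zero, WithTop.coe_lt_coe]

theorem Place.order_nonneg_iff (v : Place K) {f : K} (hf : f ≠ 0) :
    0 ≤ v.order f ↔ 0 ≤ v.ord f := by
  rw [← v.coe_order hf, ← WithTop.coe_zero, WithTop.coe_le_coe]

theorem Place.order_mul (v : Place K) {f g : K} (hf : f ≠ 0) (hg : g ≠ 0) :
    v.order (f * g) = v.order f + v.order g := by
  rw [v.order_eq_iff (mul_ne_zero hf hg), AddValuation.map_mul, WithTop.coe_add, v.coe_order hf,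
    v.coe_order hg]

theorem Place.order_inv (v : Place K) (f : K) : v.order f⁻¹ = -v.order f := by
  by_cases hf : f = 0
  · simp [hf, Place.order]
  · rw [v.order_eq_iff (inv_ne_zero hf), AddValuation.map_inv, ← v.coe_order hf]
    rfl

theorem Place.order_pow (v : Place K) {f : K} (hf : f ≠ 0) (n : ℕ) :
    v.order (f ^ n) = n * v.order f := by
  rw [v.order_eq_iff (pow_ne_zero _ hf), AddValuation.map_pow, ← v.coe_order hf, nsmul_coe]

theorem Place.order_algebraMap (v : Place K) (c : ℂ) : v.order (algebraMap ℂ K c) = 0 := by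
  by_cases hc : c = 0
  · simp [hc, Place.order]
  · simp [Place.order, v.ord_algebraMap c hc]

theorem Place.ord_algebraMap_nonneg (v : Place K) (c : ℂ) : 0 ≤ v.ord (algebraMap ℂ K c) := by
  by_cases h0 : c = 0
  · rw [h0, map_zero, AddValuation.map_zero]; exact le_top
  · rw [v.ord_algebraMap _ h0]

theorem Place.ext_order {v w : Place K} (h : ∀ f : K, f ≠ 0 → v.order f = w.order f) : v = w := by
  have h' : v.ord = w.ord := by
    ext f
    by_cases hf : f = 0
    · rw [hf, AddValuation.map_zero, AddValuation.map_zero]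
    · rw [← v.coe_order hf, ← w.coe_order hf, h f hf]
  cases v
  cases w
  congr

/-- The function `f` is regular at `v` with value `c`. -/
def Place.Residue (v : Place K) (f : K) (c : ℂ) : Prop := 0 < v.ord (f - algebraMap ℂ K c)

namespace Place.Residue

variable {v : Place K} {f g : K} {c d : ℂ}

theorem nonneg (h : v.Residue f c) : 0 ≤ v.ord f := by
  have := AddValuation.map_le_add v.ord h.le (v.ord_algebraMap_nonneg c)
  rwa [sub_add_cancel] at this

theorem const (v : Place K) (c : ℂ) : v.Residue (algebraMap ℂ K c) c := by
  rw [Residue, sub_self, AddValuation.map_zero]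
  exact WithTop.coe_lt_top 0

theorem one (v : Place K) : v.Residue (1 : K) 1 := by
  simpa using const v 1

theorem add (hf : v.Residue f c) (hg : v.Residue g d) : v.Residue (f + g) (c + d) := by
  have := AddValuation.map_lt_add v.ord hf hg
  rw [Residue, map_add]
  convert this using 2
  ring

theorem mul (hf : v.Residue f c) (hg : v.Residue g d) : v.Residue (f * g) (c * d) := by
  have e : f * g - algebraMap ℂ K (c * d) =
      f * (g - algebraMap ℂ K d) + algebraMap ℂ K d * (f - algebraMap ℂ K c) := by
    rw [map_mul]; ring
  rw [Residue, e]
  apply AddValuation.map_lt_add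
  · rw [AddValuation.map_mul]
    exact lt_of_lt_of_le hg (le_add_of_nonneg_left hf.nonneg)
  · rw [AddValuation.map_mul]
    exact lt_of_lt_of_le hf (le_add_of_nonneg_left (v.ord_algebraMap_nonneg d))

theorem neg (hf : v.Residue f c) : v.Residue (-f) (-c) := by
  simpa using (const v (-1)).mul hf

theorem sub (hf : v.Residue f c) (hg : v.Residue g d) : v.Residue (f - g) (c - d) := by
  simpa [sub_eq_add_neg] using hf.add hg.neg

theorem pow (hf : v.Residue f c) (n : ℕ) : v.Residue (f ^ n) (c ^ n) := by
  induction n with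
  | zero => simpa using one v
  | succ n ih => simpa [pow_succ] using ih.mul hf

theorem ord_eq_zero (hf : v.Residue f c) (hc : c ≠ 0) : v.ord f = 0 := by
  have h : v.ord (algebraMap ℂ K c) < v.ord (f - algebraMap ℂ K c) := by
    rw [v.ord_algebraMap c hc]; exact hf
  have := AddValuation.map_add_eq_of_lt_left v.ord h
  rwa [add_sub_cancel, v.ord_algebraMap c hc] at this

theorem order_eq_zero (hf : v.Residue f c) (hc : c ≠ 0) : v.order f = 0 := by
  rw [Place.order, hf.ord_eq_zero hc]
  rfl

theorem ne_zero (hf : v.Residue f c) (hc : c ≠ 0) : f ≠ 0 := by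
  rintro rfl
  have := hf.ord_eq_zero hc
  rw [AddValuation.map_zero] at this
  exact absurd this (by decide)

theorem inv (hf : v.Residue f c) (hc : c ≠ 0) : v.Residue f⁻¹ c⁻¹ := by
  have hf0 := hf.ne_zero hc
  have hc' : algebraMap ℂ K c ≠ 0 := (_root_.map_ne_zero _).2 hc
  have e : f⁻¹ - algebraMap ℂ K c⁻¹ =
      -(f⁻¹ * algebraMap ℂ K c⁻¹ * (f - algebraMap ℂ K c)) := by
    rw [map_inv₀]; field_simp; ring
  rw [Residue, e, AddValuation.map_neg, AddValuation.map_mul, AddValuation.map_mul,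
    AddValuation.map_inv, hf.ord_eq_zero hc, v.ord_algebraMap _ (inv_ne_zero hc)]
  simpa [Residue] using hf

theorem div (hf : v.Residue f c) (hg : v.Residue g d) (hd : d ≠ 0) :
    v.Residue (f / g) (c / d) := by
  simpa [div_eq_mul_inv] using hf.mul (hg.inv hd)

theorem unique (hf : v.Residue f c) (hg : v.Residue f d) : c = d := by
  by_contra h
  have h1 := (hf.sub hg).ne_zero (sub_ne_zero.2 h)
  simp at h1

/-- The order upstairs is a positive multiple of the order downstairs, so positivity descends. This
is how values on the quotient curve are computed from the coordinates $x,y$. -/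
theorem of_liesOver {K₀ : Type} [Field K₀] [Algebra ℂ K₀] {i : K₀ →ₐ[ℂ] K} {w : Place K₀}
    (h : v.LiesOver i w) {f : K₀} {c : ℂ} (hf : v.Residue (i f) c) : w.Residue f c := by
  obtain ⟨e, he, h⟩ := h
  have h1 := h (f - algebraMap ℂ K₀ c)
  rw [map_sub, AlgHom.commutes] at h1
  rw [Residue, h1] at hf
  by_contra h2
  rw [Residue, not_lt] at h2
  have := (nsmul_le_nsmul_iff he _ _).2 h2
  rw [nsmul_zero] at this
  exact absurd hf this.not_gt

theorem nonneg_of_mem_adjoin {S : Set K} (hS : ∀ f ∈ S, ∃ c, v.Residue f c) {r : K}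
    (hr : r ∈ Algebra.adjoin ℂ S) : 0 ≤ v.ord r := by
  induction hr using Algebra.adjoin_induction with
  | mem x hx => exact (hS x hx).choose_spec.nonneg
  | algebraMap c => exact v.ord_algebraMap_nonneg c
  | add x y _ _ hx hy => exact AddValuation.map_le_add _ hx hy
  | mul x y _ _ hx hy => rw [AddValuation.map_mul]; exact add_nonneg hx hy

end Place.Residue

/-- First-order Taylor expansion at the point $(c,0)$, with remainder coefficients kept in the
coordinate ring: a polynomial without constant term lies in the ideal $(z-c,\,t)$. -/
theorem exists_eq_const_add_of_mem_adjoin {z t : K} (c : ℂ) {r : K}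
    (hr : r ∈ Algebra.adjoin ℂ {z, t}) :
    ∃ d : ℂ, ∃ A ∈ Algebra.adjoin ℂ {z, t}, ∃ B ∈ Algebra.adjoin ℂ {z, t},
      r = algebraMap ℂ K d + A * (z - algebraMap ℂ K c) + B * t := by
  have ht : t ∈ Algebra.adjoin ℂ {z, t} := Algebra.subset_adjoin (by simp)
  have hz : z ∈ Algebra.adjoin ℂ {z, t} := Algebra.subset_adjoin (by simp)
  induction hr using Algebra.adjoin_induction with
  | mem x hx =>
    rcases hx with rfl | rfl
    · exact ⟨c, 1, one_mem _, 0, zero_mem _, by ring⟩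
    · exact ⟨0, 0, zero_mem _, 1, one_mem _, by simp⟩
  | algebraMap d => exact ⟨d, 0, zero_mem _, 0, zero_mem _, by ring⟩
  | add x y _ _ hx hy =>
    obtain ⟨d, A, hA, B, hB, rfl⟩ := hx
    obtain ⟨d', A', hA', B', hB', rfl⟩ := hy
    exact ⟨d + d', A + A', add_mem hA hA', B + B', add_mem hB hB', by rw [map_add]; ring⟩
  | mul x y hx' hy' hx hy =>
    obtain ⟨d, A, hA, B, hB, rfl⟩ := hx
    obtain ⟨d', A', hA', B', hB', h⟩ := hy
    refine ⟨d * d', A * y + algebraMap ℂ K d * A',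
      add_mem (mul_mem hA hy') (mul_mem (Subalgebra.algebraMap_mem _ _) hA'),
      B * y + algebraMap ℂ K d * B',
      add_mem (mul_mem hB hy') (mul_mem (Subalgebra.algebraMap_mem _ _) hB'), ?_⟩
    rw [map_mul]
    linear_combination algebraMap ℂ K d * h

/-- At a smooth point `(z, t) = (c, 0)` of a plane model, where `t` generates the maximal ideal
because `s (z - c) = q t` with a local unit `s`, there is only one place, and `t` is a local
parameter. -/
theorem Place.eq_of_smooth {v v' : Place K} {z t s q : K} {c : ℂ}
    (hgen : IntermediateField.adjoin ℂ {z, t} = ⊤) (ht0 : t ≠ 0)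
    (hz : v.Residue z c) (hz' : v'.Residue z c) (ht : v.Residue t 0) (ht' : v'.Residue t 0)
    (hs : s ∈ Algebra.adjoin ℂ {z, t}) (hq : q ∈ Algebra.adjoin ℂ {z, t})
    {d : ℂ} (hd : d ≠ 0) (hvs : v.Residue s d) (hvs' : v'.Residue s d)
    (h : s * (z - algebraMap ℂ K c) = q * t) : v = v' ∧ v.order t = 1 := by
  have hs0 := hvs.ne_zero hd
  have hnn : ∀ w : Place K, w.Residue z c → w.Residue t 0 → ∀ r ∈ Algebra.adjoin ℂ {z, t},
      0 ≤ w.ord r := fun w h1 h2 r hr => Place.Residue.nonneg_of_mem_adjoin (S := {z, t})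
    (by rintro f (rfl | rfl); exacts [⟨_, h1⟩, ⟨_, h2⟩]) hr
  -- The constant term of the expansion is the residue at every place centred at $(c,0)$. Whether an
  -- element is a unit there is thus the same question for `v` and `v'`.
  have hval : ∀ w : Place K, w.Residue z c → w.Residue t 0 → ∀ r : K, ∀ e : ℂ,
      ∀ A ∈ Algebra.adjoin ℂ {z, t}, ∀ B ∈ Algebra.adjoin ℂ {z, t},
      r = algebraMap ℂ K e + A * (z - algebraMap ℂ K c) + B * t → w.Residue r e := by
    intro w h1 h2 r e A hA B hB hr
    have h3 : r - algebraMap ℂ K e = A * (z - algebraMap ℂ K c) + B * t := by rw [hr]; ring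
    rw [Place.Residue, h3]
    apply AddValuation.map_lt_add
    · rw [AddValuation.map_mul]
      exact lt_of_lt_of_le h1 (le_add_of_nonneg_left (hnn w ‹_› ‹_› A hA))
    · rw [AddValuation.map_mul]
      rw [Place.Residue, map_zero, sub_zero] at h2
      exact lt_of_lt_of_le h2 (le_add_of_nonneg_left (hnn w h1 (by simpa [Place.Residue] using h2) B hB))
  have htpos : 0 < v.order t := by
    rw [v.order_pos_iff ht0]; simpa [Place.Residue] using ht
  -- Divide by `t` until a unit is left; the same number `k` of divisions serves both places. The
  -- induction is on a bound for the order at `v`, which drops at each division.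
  have key : ∀ n : ℕ, ∀ r ∈ Algebra.adjoin ℂ {z, t}, r ≠ 0 → v.order r ≤ n →
      ∃ k : ℤ, v.order r = k * v.order t ∧ v'.order r = k * v'.order t := by
    intro n
    induction n with
    | zero =>
      intro r hr hr0 hn
      obtain ⟨e, A, hA, B, hB, hre⟩ := exists_eq_const_add_of_mem_adjoin c hr
      have hv := hval v hz ht r e A hA B hB hre
      have hv' := hval v' hz' ht' r e A hA B hB hre
      have he : e ≠ 0 := by
        rintro rfl
        rw [Place.Residue, map_zero, sub_zero, ← v.order_pos_iff hr0] at hv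
        push_cast at hn
        omega
      exact ⟨0, by rw [hv.order_eq_zero he, zero_mul], by rw [hv'.order_eq_zero he, zero_mul]⟩
    | succ n ih =>
      intro r hr hr0 hn
      obtain ⟨e, A, hA, B, hB, hre⟩ := exists_eq_const_add_of_mem_adjoin c hr
      have hv := hval v hz ht r e A hA B hB hre
      have hv' := hval v' hz' ht' r e A hA B hB hre
      by_cases he : e = 0
      · subst he
        -- Multiplying by the local unit `s` turns `z - c` into a multiple of `t`, so a non-unit is
        -- divisible by `t` without leaving the ring.
        have hmul : s * r = (A * q + B * s) * t := by
          rw [hre, map_zero]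
          linear_combination A * h
        have hr' : A * q + B * s ≠ 0 := by
          intro h0
          rw [h0, zero_mul] at hmul
          exact mul_ne_zero hs0 hr0 hmul
        have h1 := congrArg v.order hmul
        have h2 := congrArg v'.order hmul
        rw [v.order_mul hs0 hr0, v.order_mul hr' ht0, hvs.order_eq_zero hd, zero_add] at h1
        rw [v'.order_mul hs0 hr0, v'.order_mul hr' ht0, hvs'.order_eq_zero hd, zero_add] at h2
        obtain ⟨k, hk, hk'⟩ := ih _ (add_mem (mul_mem hA hq) (mul_mem hB hs)) hr'
          (by push_cast at hn; omega)
        exact ⟨k + 1, by rw [h1, hk]; ring, by rw [h2, hk']; ring⟩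
      · exact ⟨0, by rw [hv.order_eq_zero he, zero_mul], by rw [hv'.order_eq_zero he, zero_mul]⟩
  have key' : ∀ f : K, f ≠ 0 →
      ∃ k : ℤ, v.order f = k * v.order t ∧ v'.order f = k * v'.order t := by
    intro f hf
    have hmem : f ∈ IntermediateField.adjoin ℂ {z, t} := hgen ▸ IntermediateField.mem_top
    obtain ⟨a, ha, b, hb, rfl⟩ := IntermediateField.mem_adjoin_iff_div.1 hmem
    have ha0 : a ≠ 0 := by rintro rfl; simp at hf
    have hb0 : b ≠ 0 := by rintro rfl; simp at hf
    obtain ⟨k, hk, hk'⟩ := key (v.order a).toNat a ha ha0 (Int.self_le_toNat _)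
    obtain ⟨j, hj, hj'⟩ := key (v.order b).toNat b hb hb0 (Int.self_le_toNat _)
    refine ⟨k - j, ?_, ?_⟩
    · rw [div_eq_mul_inv, v.order_mul ha0 (inv_ne_zero hb0), v.order_inv, hk, hj]; ring
    · rw [div_eq_mul_inv, v'.order_mul ha0 (inv_ne_zero hb0), v'.order_inv, hk', hj']; ring
  -- All orders are multiples of the order of `t`; since places are normalized, that order divides
  -- one.
  have hone : ∀ w : Place K, ∃ f : K, f ≠ 0 ∧ w.order f = 1 := by
    intro w
    obtain ⟨f, hf⟩ := w.surjective 1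
    have hf0 : f ≠ 0 := by
      rintro rfl
      rw [AddValuation.map_zero] at hf
      exact absurd hf (by decide)
    exact ⟨f, hf0, (w.order_eq_iff hf0 1).2 hf⟩
  have htpos' : 0 < v'.order t := by
    rw [v'.order_pos_iff ht0]; simpa [Place.Residue] using ht'
  have h1 : v.order t = 1 := by
    obtain ⟨f, hf, hf1⟩ := hone v
    obtain ⟨k, hk, -⟩ := key' f hf
    exact Int.eq_one_of_dvd_one htpos.le ⟨k, by rw [mul_comm, ← hk, hf1]⟩
  have h1' : v'.order t = 1 := by
    obtain ⟨f, hf, hf1⟩ := hone v'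
    obtain ⟨k, -, hk⟩ := key' f hf
    exact Int.eq_one_of_dvd_one htpos'.le ⟨k, by rw [mul_comm, ← hk, hf1]⟩
  refine ⟨Place.ext_order fun f hf => ?_, h1⟩
  obtain ⟨k, hk, hk'⟩ := key' f hf
  rw [hk, hk', h1, h1']

end Place

/-! ### Divisors on the curve $W^p(U-\gamma)(U-\delta)=\kappa(U-\alpha)(U-\beta)$. -/

section CyclicModel

variable {K : Type} [Field K] [Algebra ℂ K]

theorem sub_const_ne_zero {f : K} (hf : f ∉ Set.range (algebraMap ℂ K)) (c : ℂ) :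
    f - algebraMap ℂ K c ≠ 0 := fun h => hf ⟨c, (sub_eq_zero.1 h).symm⟩

theorem ne_zero_of_not_mem_range {f : K} (hf : f ∉ Set.range (algebraMap ℂ K)) : f ≠ 0 := by
  simpa using sub_const_ne_zero hf 0

theorem Place.residue_iff_order_pos (v : Place K) {f : K} {c : ℂ}
    (hf : f - algebraMap ℂ K c ≠ 0) : v.Residue f c ↔ 0 < v.order (f - algebraMap ℂ K c) := by
  rw [v.order_pos_iff hf, Place.Residue]

theorem Place.residue_zero_iff (v : Place K) {f : K} (hf : f ≠ 0) :
    v.Residue f 0 ↔ 0 < v.order f := by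
  rw [v.order_pos_iff hf, Place.Residue, map_zero, sub_zero]

theorem Place.order_sub_of_neg (v : Place K) {f : K} (h : v.order f < 0) (c : ℂ) :
    v.order (f - algebraMap ℂ K c) = v.order f := by
  have hf : f ≠ 0 := by
    rintro rfl
    simp [Place.order] at h
  have h1 : v.ord f < v.ord (algebraMap ℂ K c) := by
    refine lt_of_lt_of_le ?_ (v.ord_algebraMap_nonneg c)
    rw [← v.coe_order hf]
    exact_mod_cast h
  rw [Place.order, AddValuation.map_sub_eq_of_lt_left v.ord h1, Place.order]

theorem Place.order_sub_nonneg (v : Place K) {f : K} (h : 0 ≤ v.order f) (c : ℂ) :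
    0 ≤ v.order (f - algebraMap ℂ K c) := by
  by_cases hf : f = 0
  · rw [hf, zero_sub, ← map_neg, v.order_algebraMap]
  by_cases hfc : f - algebraMap ℂ K c = 0
  · simp [hfc, Place.order]
  rw [v.order_nonneg_iff hfc, sub_eq_add_neg]
  apply AddValuation.map_le_add
  · rwa [← v.order_nonneg_iff hf]
  · rw [AddValuation.map_neg]
    exact v.ord_algebraMap_nonneg c

theorem Place.Residue.order_nonneg {v : Place K} {f : K} {c : ℂ} (h : v.Residue f c) :
    0 ≤ v.order f := by
  by_cases hf : f = 0
  · simp [hf, Place.order]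
  · rw [v.order_nonneg_iff hf]
    exact h.nonneg

theorem Place.Residue.order_sub_eq_zero {v : Place K} {f : K} {c d : ℂ} (h : v.Residue f c)
    (hcd : c ≠ d) : v.order (f - algebraMap ℂ K d) = 0 :=
  (h.sub (.const v d)).order_eq_zero (sub_ne_zero.2 hcd)

theorem order_relation {v : Place K} {A B C D E : K} {κ : ℂ} (hκ : κ ≠ 0) (hA : A ≠ 0) (hB : B ≠ 0)
    (hC : C ≠ 0) (hD : D ≠ 0) (hE : E ≠ 0) (h : A * (B * C) = algebraMap ℂ K κ * (D * E)) :
    v.order A + v.order B + v.order C = v.order D + v.order E := by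
  have h1 := congrArg v.order h
  rw [v.order_mul hA (mul_ne_zero hB hC), v.order_mul hB hC,
    v.order_mul ((_root_.map_ne_zero _).2 hκ) (mul_ne_zero hD hE), v.order_algebraMap,
    v.order_mul hD hE] at h1
  omega

variable {p : ℕ} {U W : K} {α β γ δ κ : ℂ}

/-- On the curve `W ^ p (U - γ) (U - δ) = κ (U - α) (U - β)` there is at most one place over
`U = α`; it is totally ramified, and `W` is a local parameter. -/
theorem eq_of_residue_zero (hp : p ≠ 0) (hU : U ∉ Set.range (algebraMap ℂ K)) (hW : W ≠ 0)
    (hgen : IntermediateField.adjoin ℂ {U, W} = ⊤) (hκ : κ ≠ 0)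
    (hrel : W ^ p * ((U - algebraMap ℂ K γ) * (U - algebraMap ℂ K δ)) =
      algebraMap ℂ K κ * ((U - algebraMap ℂ K α) * (U - algebraMap ℂ K β)))
    (hαβ : α ≠ β) (hαγ : α ≠ γ) (hαδ : α ≠ δ) {v v' : Place K}
    (hv : v.Residue U α) (hv' : v'.Residue U α) :
    v = v' ∧ v.order (U - algebraMap ℂ K α) = p := by
  have hord : ∀ w : Place K, w.Residue U α →
      w.order (U - algebraMap ℂ K α) = p * w.order W := by
    intro w hw
    have h1 := order_relation (v := w) hκ (pow_ne_zero p hW) (sub_const_ne_zero hU γ)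
      (sub_const_ne_zero hU δ) (sub_const_ne_zero hU α) (sub_const_ne_zero hU β) hrel
    rw [w.order_pow hW, hw.order_sub_eq_zero hαβ, hw.order_sub_eq_zero hαγ,
      hw.order_sub_eq_zero hαδ] at h1
    omega
  have hW0 : ∀ w : Place K, w.Residue U α → w.Residue W 0 := by
    intro w hw
    have h1 := hord w hw
    rw [w.residue_iff_order_pos (sub_const_ne_zero hU α), h1] at hw
    rw [w.residue_zero_iff hW]
    exact pos_of_mul_pos_right hw (Int.natCast_nonneg p)
  have hUm : U ∈ Algebra.adjoin ℂ {U, W} := Algebra.subset_adjoin (by simp)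
  have hWm : W ∈ Algebra.adjoin ℂ {U, W} := Algebra.subset_adjoin (by simp)
  have hc : ∀ c : ℂ, algebraMap ℂ K c ∈ Algebra.adjoin ℂ {U, W} :=
    fun c => Subalgebra.algebraMap_mem _ c
  have hres : ∀ w : Place K, w.Residue U α →
      w.Residue (algebraMap ℂ K κ * (U - algebraMap ℂ K β)) (κ * (α - β)) :=
    fun w hw => (Place.Residue.const w κ).mul (hw.sub (.const w β))
  -- The defining relation, with one factor `W` split off from $W^p$, expresses $U-\alpha$ as a
  -- multiple of `W` up to the unit $\kappa(U-\beta)$.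
  obtain ⟨h1, h2⟩ := Place.eq_of_smooth (s := algebraMap ℂ K κ * (U - algebraMap ℂ K β))
    (q := W ^ (p - 1) * ((U - algebraMap ℂ K γ) * (U - algebraMap ℂ K δ))) hgen hW hv hv'
    (hW0 v hv) (hW0 v' hv') (mul_mem (hc _) (sub_mem hUm (hc _)))
    (mul_mem (pow_mem hWm _) (mul_mem (sub_mem hUm (hc _)) (sub_mem hUm (hc _))))
    (mul_ne_zero hκ (sub_ne_zero.2 hαβ)) (hres v hv) (hres v' hv') (by
      rw [← mul_pow_sub_one hp W] at hrel
      linear_combination -hrel)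
  exact ⟨h1, by rw [hord v hv, h2, mul_one]⟩

/-- On the curve `W ^ p (U - γ) (U - δ) = κ (U - α) (U - β)` there is at most one place over a point
`(r, ω)` of the affine model where `U` is unramified over `W`. -/
theorem eq_of_residue_fiber {r s ω μ : ℂ} (hW : W - algebraMap ℂ K ω ≠ 0)
    (hgen : IntermediateField.adjoin ℂ {U, W} = ⊤) (hμ : μ ≠ 0)
    (hfib : (W ^ p - algebraMap ℂ K ω ^ p) * ((U - algebraMap ℂ K γ) * (U - algebraMap ℂ K δ)) =
      algebraMap ℂ K μ * ((U - algebraMap ℂ K r) * (U - algebraMap ℂ K s)))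
    (hrs : r ≠ s) {v v' : Place K}
    (hv : v.Residue U r) (hv' : v'.Residue U r) (hvW : v.Residue W ω) (hvW' : v'.Residue W ω) :
    v = v' ∧ v.order (W - algebraMap ℂ K ω) = 1 := by
  set T := W - algebraMap ℂ K ω with hT
  have hUm : U ∈ Algebra.adjoin ℂ {U, T} := Algebra.subset_adjoin (by simp)
  have hTm : T ∈ Algebra.adjoin ℂ {U, T} := Algebra.subset_adjoin (by simp)
  have hc : ∀ c : ℂ, algebraMap ℂ K c ∈ Algebra.adjoin ℂ {U, T} :=
    fun c => Subalgebra.algebraMap_mem _ c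
  have hWT : W = T + algebraMap ℂ K ω := by rw [hT]; ring
  have hWm : W ∈ Algebra.adjoin ℂ {U, T} := hWT ▸ add_mem hTm (hc ω)
  have hgen' : IntermediateField.adjoin ℂ {U, T} = ⊤ := by
    rw [← top_le_iff, ← hgen, IntermediateField.adjoin_le_iff]
    have hle := IntermediateField.algebra_adjoin_le_adjoin ℂ {U, T}
    rintro f (rfl | rfl)
    · exact hle hUm
    · exact hle hWm
  have hT0 : ∀ w : Place K, w.Residue W ω → w.Residue T 0 := by
    intro w hw
    simpa using hw.sub (.const w ω)
  have hres : ∀ w : Place K, w.Residue U r →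
      w.Residue (algebraMap ℂ K μ * (U - algebraMap ℂ K s)) (μ * (r - s)) :=
    fun w hw => (Place.Residue.const w μ).mul (hw.sub (.const w s))
  refine Place.eq_of_smooth (s := algebraMap ℂ K μ * (U - algebraMap ℂ K s))
    (q := (∑ i ∈ Finset.range p, W ^ i * algebraMap ℂ K ω ^ (p - 1 - i)) *
      ((U - algebraMap ℂ K γ) * (U - algebraMap ℂ K δ))) hgen' hW hv hv'
    (hT0 v hvW) (hT0 v' hvW') (mul_mem (hc _) (sub_mem hUm (hc _)))
    (mul_mem (sum_mem fun i _ => mul_mem (pow_mem hWm _) (pow_mem (hc _) _))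
      (mul_mem (sub_mem hUm (hc _)) (sub_mem hUm (hc _))))
    (mul_ne_zero hμ (sub_ne_zero.2 hrs)) (hres v hv) (hres v' hv') ?_
  -- The geometric sum splits $W-\omega$ off from $W^p-\omega^p$, which leaves the cofactor `q`.
  rw [← (Commute.all W (algebraMap ℂ K ω)).geom_sum₂_mul] at hfib
  linear_combination -hfib

/-- The model `W ^ p (U - γ) (U - δ) = κ (U - α) (U - β)` of a curve, together with a fibre
`{(r, ω), (s, ω)}` of the double covering `W`. -/
structure CyclicModel (p : ℕ) (U W : K) (α β γ δ κ r s ω μ : ℂ) : Prop where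
  exponent_ne_zero : p ≠ 0
  transcendental : U ∉ Set.range (algebraMap ℂ K)
  generates : IntermediateField.adjoin ℂ {U, W} = ⊤
  leading_ne_zero : κ ≠ 0
  relation : W ^ p * ((U - algebraMap ℂ K γ) * (U - algebraMap ℂ K δ)) =
    algebraMap ℂ K κ * ((U - algebraMap ℂ K α) * (U - algebraMap ℂ K β))
  ne_αβ : α ≠ β
  ne_αγ : α ≠ γ
  ne_αδ : α ≠ δ
  ne_βγ : β ≠ γ
  ne_βδ : β ≠ δ
  ne_γδ : γ ≠ δ
  value_ne_zero : ω ≠ 0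
  fiber_leading_ne_zero : μ ≠ 0
  fiber : (W ^ p - algebraMap ℂ K ω ^ p) * ((U - algebraMap ℂ K γ) * (U - algebraMap ℂ K δ)) =
    algebraMap ℂ K μ * ((U - algebraMap ℂ K r) * (U - algebraMap ℂ K s))
  ne_rs : r ≠ s
  ne_rγ : r ≠ γ
  ne_rδ : r ≠ δ
  ne_sγ : s ≠ γ
  ne_sδ : s ≠ δ

namespace CyclicModel

variable {r s ω μ : ℂ}

theorem ne_zero (M : CyclicModel p U W α β γ δ κ r s ω μ) : W ≠ 0 := by
  intro h
  have h1 := M.relation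
  rw [h, zero_pow M.exponent_ne_zero, zero_mul] at h1
  exact mul_ne_zero ((_root_.map_ne_zero _).2 M.leading_ne_zero)
    (mul_ne_zero (sub_const_ne_zero M.transcendental α) (sub_const_ne_zero M.transcendental β))
    h1.symm

theorem pow_sub_ne_zero (M : CyclicModel p U W α β γ δ κ r s ω μ) :
    W ^ p - algebraMap ℂ K ω ^ p ≠ 0 := by
  intro h
  have h1 := M.fiber
  rw [h, zero_mul] at h1
  exact mul_ne_zero ((_root_.map_ne_zero _).2 M.fiber_leading_ne_zero)
    (mul_ne_zero (sub_const_ne_zero M.transcendental r) (sub_const_ne_zero M.transcendental s))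
    h1.symm

theorem sub_ne_zero (M : CyclicModel p U W α β γ δ κ r s ω μ) : W - algebraMap ℂ K ω ≠ 0 := by
  intro h
  apply M.pow_sub_ne_zero
  rw [_root_.sub_eq_zero.1 h, sub_self]

/-- The model is symmetric in its two zeros, in its two poles and in the two points of the fibre.
These three symmetries let each local computation be made at one point only. -/
theorem swap_zeros (M : CyclicModel p U W α β γ δ κ r s ω μ) :
    CyclicModel p U W β α γ δ κ r s ω μ :=
  ⟨M.exponent_ne_zero, M.transcendental, M.generates, M.leading_ne_zero,
    by rw [M.relation]; ring, M.ne_αβ.symm, M.ne_βγ, M.ne_βδ, M.ne_αγ, M.ne_αδ, M.ne_γδ,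
    M.value_ne_zero, M.fiber_leading_ne_zero, M.fiber, M.ne_rs, M.ne_rγ, M.ne_rδ, M.ne_sγ, M.ne_sδ⟩

theorem swap_poles (M : CyclicModel p U W α β γ δ κ r s ω μ) :
    CyclicModel p U W α β δ γ κ r s ω μ :=
  ⟨M.exponent_ne_zero, M.transcendental, M.generates, M.leading_ne_zero,
    by rw [← M.relation]; ring, M.ne_αβ, M.ne_αδ, M.ne_αγ, M.ne_βδ, M.ne_βγ, M.ne_γδ.symm,
    M.value_ne_zero, M.fiber_leading_ne_zero, by rw [← M.fiber]; ring, M.ne_rs, M.ne_rδ, M.ne_rγ,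
    M.ne_sδ, M.ne_sγ⟩

theorem swap_fiber (M : CyclicModel p U W α β γ δ κ r s ω μ) :
    CyclicModel p U W α β γ δ κ s r ω μ :=
  ⟨M.exponent_ne_zero, M.transcendental, M.generates, M.leading_ne_zero, M.relation, M.ne_αβ,
    M.ne_αγ, M.ne_αδ, M.ne_βγ, M.ne_βδ, M.ne_γδ, M.value_ne_zero, M.fiber_leading_ne_zero,
    by rw [M.fiber]; ring, M.ne_rs.symm, M.ne_sγ, M.ne_sδ, M.ne_rγ, M.ne_rδ⟩

theorem eq_of_zero (M : CyclicModel p U W α β γ δ κ r s ω μ) {v v' : Place K}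
    (hv : v.Residue U α) (hv' : v'.Residue U α) :
    v = v' ∧ v.order (U - algebraMap ℂ K α) = p :=
  eq_of_residue_zero M.exponent_ne_zero M.transcendental M.ne_zero M.generates M.leading_ne_zero
    M.relation M.ne_αβ M.ne_αγ M.ne_αδ hv hv'

/-- Replacing `W` by its inverse exchanges zeros and poles of the model and inverts $\kappa$, so the
case of a zero applies. -/
theorem eq_of_pole (M : CyclicModel p U W α β γ δ κ r s ω μ) {v v' : Place K}
    (hv : v.Residue U γ) (hv' : v'.Residue U γ) :
    v = v' ∧ v.order (U - algebraMap ℂ K γ) = p := by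
  have hκ : algebraMap ℂ K κ ≠ 0 := (_root_.map_ne_zero _).2 M.leading_ne_zero
  have hgen : IntermediateField.adjoin ℂ {U, W⁻¹} = ⊤ := by
    rw [← top_le_iff, ← M.generates, IntermediateField.adjoin_le_iff]
    rintro f (rfl | rfl)
    · exact IntermediateField.subset_adjoin ℂ _ (by simp)
    · rw [← inv_inv f]
      exact inv_mem (IntermediateField.subset_adjoin ℂ _ (by simp))
  refine eq_of_residue_zero M.exponent_ne_zero M.transcendental (inv_ne_zero M.ne_zero) hgen
    (inv_ne_zero M.leading_ne_zero) (γ := α) (δ := β) (α := γ) (β := δ) ?_ M.ne_γδ M.ne_αγ.symm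
    M.ne_βγ.symm hv hv'
  have hWp := pow_ne_zero p M.ne_zero
  have h := M.relation
  rw [inv_pow, map_inv₀]
  field_simp
  linear_combination -h

/-- The divisor of `U - ε`, for a branch point `ε`. -/
theorem order_sub_branch [DecidableEq (Place K)] (M : CyclicModel p U W α β γ δ κ r s ω μ) {ε : ℂ}
    (hε : ε = α ∨ ε = β ∨ ε = γ ∨ ε = δ) {e : Place K} (he : e.Residue U ε) (v : Place K) :
    v.order (U - algebraMap ℂ K ε) = p * (if v = e then 1 else 0) + min 0 (v.order U) := by
  have key : ∀ v, v.Residue U ε → v = e ∧ v.order (U - algebraMap ℂ K ε) = p := by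
    intro v hv
    rcases hε with rfl | rfl | rfl | rfl
    · exact M.eq_of_zero hv he
    · exact M.swap_zeros.eq_of_zero hv he
    · exact M.eq_of_pole hv he
    · exact M.swap_poles.eq_of_pole hv he
  -- The term `min 0 (v.order U)` records the poles of `U`. It does not depend on `ε`, which is why
  -- it cancels in the final quotient.
  by_cases hv : v.Residue U ε
  · obtain ⟨rfl, h⟩ := key v hv
    rw [h, if_pos rfl, min_eq_left hv.order_nonneg]
    ring
  · rw [if_neg (by rintro rfl; exact hv he)]
    rw [v.residue_iff_order_pos (sub_const_ne_zero M.transcendental ε)] at hv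
    rcases lt_or_ge (v.order U) 0 with h | h
    · rw [v.order_sub_of_neg h, min_eq_right h.le]
      ring
    · have := v.order_sub_nonneg h ε
      rw [min_eq_left h]
      omega

/-- The divisor of `(W - ω) ^ p (U - γ) (U - δ)`. -/
theorem order_fiber [DecidableEq (Place K)] (M : CyclicModel p U W α β γ δ κ r s ω μ)
    {P Q : Place K} (hP : P.Residue U r) (hPW : P.Residue W ω) (hQ : Q.Residue U s)
    (hQW : Q.Residue W ω) (v : Place K) :
    p * v.order (W - algebraMap ℂ K ω) + v.order (U - algebraMap ℂ K γ) +
      v.order (U - algebraMap ℂ K δ) =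
      p * ((if v = P then 1 else 0) + if v = Q then 1 else 0) + 2 * min 0 (v.order U) := by
  have hPQ : P ≠ Q := by
    rintro rfl
    exact M.ne_rs (hP.unique hQ)
  by_cases hvP : v = P
  · subst hvP
    rw [if_pos rfl, if_neg hPQ, min_eq_left hP.order_nonneg, hP.order_sub_eq_zero M.ne_rγ,
      hP.order_sub_eq_zero M.ne_rδ, (eq_of_residue_fiber M.sub_ne_zero M.generates
        M.fiber_leading_ne_zero M.fiber M.ne_rs hP hP hPW hPW).2]
    ring
  by_cases hvQ : v = Q
  · subst hvQ
    rw [if_neg hvP, if_pos rfl, min_eq_left hQ.order_nonneg, hQ.order_sub_eq_zero M.ne_sγ,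
      hQ.order_sub_eq_zero M.ne_sδ, (eq_of_residue_fiber M.sub_ne_zero M.generates
        M.fiber_leading_ne_zero M.swap_fiber.fiber M.ne_rs.symm hQ hQ hQW hQW).2]
    ring
  rw [if_neg hvP, if_neg hvQ]
  have hU := M.transcendental
  have hp := M.exponent_ne_zero
  have hppos : (0 : ℤ) < p := by exact_mod_cast Nat.pos_of_ne_zero hp
  have hrel := order_relation (v := v) M.leading_ne_zero (pow_ne_zero p M.ne_zero)
    (sub_const_ne_zero hU γ) (sub_const_ne_zero hU δ) (sub_const_ne_zero hU α)
    (sub_const_ne_zero hU β) M.relation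
  have hfib := order_relation (v := v) M.fiber_leading_ne_zero M.pow_sub_ne_zero
    (sub_const_ne_zero hU γ) (sub_const_ne_zero hU δ) (sub_const_ne_zero hU r)
    (sub_const_ne_zero hU s) M.fiber
  rw [v.order_pow M.ne_zero] at hrel
  have hWω : v.Residue W ω → 0 < v.order (W ^ p - algebraMap ℂ K ω ^ p) := by
    intro h
    have h1 := h.pow p
    rwa [v.residue_iff_order_pos (by rw [map_pow]; exact M.pow_sub_ne_zero), map_pow] at h1
  -- At a pole of `U` both quadratic factors of the relation have the same order, so `W` is a unit.
  -- The fibre equation likewise makes $W^p-\omega^p$ a unit.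
  rcases lt_or_ge (v.order U) 0 with h | h
  · simp only [v.order_sub_of_neg h] at hrel hfib ⊢
    have hW0 : v.order W = 0 := by
      have : (p : ℤ) * v.order W = 0 := by omega
      rcases mul_eq_zero.1 this with h | h
      · exact absurd h hppos.ne'
      · exact h
    have h1 := v.order_sub_nonneg hW0.ge ω
    have h2 : ¬ 0 < v.order (W - algebraMap ℂ K ω) := by
      rw [← v.residue_iff_order_pos M.sub_ne_zero]
      intro h3
      have := hWω h3
      omega
    have h3 : v.order (W - algebraMap ℂ K ω) = 0 := by omega
    rw [h3, min_eq_right h.le]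
    ring
  rw [min_eq_left h]
  have hres : ∀ c, 0 < v.order (U - algebraMap ℂ K c) → v.Residue U c := fun c =>
    (v.residue_iff_order_pos (sub_const_ne_zero hU c)).2
  have hα := v.order_sub_nonneg h α
  have hβ := v.order_sub_nonneg h β
  have hγ := v.order_sub_nonneg h γ
  have hδ := v.order_sub_nonneg h δ
  rcases lt_trichotomy (v.order W) 0 with hW | hW | hW
  -- At a pole of `W` the value of `U` is $\gamma$ or $\delta$; the factors $U-\alpha$, $U-\beta$
  -- are units, and the relation says exactly that the sum vanishes.
  · rw [v.order_sub_of_neg hW]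
    have hneg : (p : ℤ) * v.order W < 0 := mul_neg_of_pos_of_neg hppos hW
    have : v.order (U - algebraMap ℂ K α) = 0 ∧ v.order (U - algebraMap ℂ K β) = 0 := by
      rcases (by omega : 0 < v.order (U - algebraMap ℂ K γ) ∨
        0 < v.order (U - algebraMap ℂ K δ)) with h1 | h1
      · exact ⟨(hres _ h1).order_sub_eq_zero M.ne_αγ.symm,
          (hres _ h1).order_sub_eq_zero M.ne_βγ.symm⟩
      · exact ⟨(hres _ h1).order_sub_eq_zero M.ne_αδ.symm,
          (hres _ h1).order_sub_eq_zero M.ne_βδ.symm⟩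
    omega
  · have h1 := v.order_sub_nonneg hW.ge ω
    -- If `W` had value $\omega$, the fibre equation would give `U` the value $r$ or $s$, and
    -- uniqueness of the place there would force `v` to be `P` or `Q`.
    have h2 : ¬ 0 < v.order (W - algebraMap ℂ K ω) := by
      rw [← v.residue_iff_order_pos M.sub_ne_zero]
      intro h3
      have := hWω h3
      rcases (by omega : 0 < v.order (U - algebraMap ℂ K r) ∨
        0 < v.order (U - algebraMap ℂ K s)) with h4 | h4
      · exact hvP (eq_of_residue_fiber M.sub_ne_zero M.generates M.fiber_leading_ne_zero M.fiber
          M.ne_rs (hres _ h4) hP h3 hPW).1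
      · exact hvQ (eq_of_residue_fiber M.sub_ne_zero M.generates M.fiber_leading_ne_zero
          M.swap_fiber.fiber M.ne_rs.symm (hres _ h4) hQ h3 hQW).1
    have h3 : v.order (W - algebraMap ℂ K ω) = 0 := by omega
    -- Since `W` is a unit, the relation balances zeros at $\gamma,\delta$ against zeros at
    -- $\alpha,\beta$. These values are distinct, so neither side can vanish.
    have h4 : v.order (U - algebraMap ℂ K γ) = 0 ∧ v.order (U - algebraMap ℂ K δ) = 0 := by
      rw [hW, mul_zero] at hrel
      by_contra hne
      have : v.order (U - algebraMap ℂ K α) = 0 ∧ v.order (U - algebraMap ℂ K β) = 0 := by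
        rcases (by omega : 0 < v.order (U - algebraMap ℂ K γ) ∨
          0 < v.order (U - algebraMap ℂ K δ)) with h1 | h1
        · exact ⟨(hres _ h1).order_sub_eq_zero M.ne_αγ.symm,
            (hres _ h1).order_sub_eq_zero M.ne_βγ.symm⟩
        · exact ⟨(hres _ h1).order_sub_eq_zero M.ne_αδ.symm,
            (hres _ h1).order_sub_eq_zero M.ne_βδ.symm⟩
      omega
    rw [h3, h4.1, h4.2]
    ring
  · have h3 : v.order (W - algebraMap ℂ K ω) = 0 :=
      ((v.residue_zero_iff M.ne_zero).2 hW).order_sub_eq_zero M.value_ne_zero.symm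
    have hpos : 0 < (p : ℤ) * v.order W := mul_pos hppos hW
    have : v.order (U - algebraMap ℂ K γ) = 0 ∧ v.order (U - algebraMap ℂ K δ) = 0 := by
      rcases (by omega : 0 < v.order (U - algebraMap ℂ K α) ∨
        0 < v.order (U - algebraMap ℂ K β)) with h1 | h1
      · exact ⟨(hres _ h1).order_sub_eq_zero M.ne_αγ, (hres _ h1).order_sub_eq_zero M.ne_αδ⟩
      · exact ⟨(hres _ h1).order_sub_eq_zero M.ne_βγ, (hres _ h1).order_sub_eq_zero M.ne_βδ⟩
    rw [h3, this.1, this.2]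
    ring

/-- The divisor `p ([P] + [Q] - 2 [e])`, for a branch point `e` and a fibre `{P, Q}` of the double
covering `W`, is principal. -/
theorem nsmul_mem_principalDivisors (M : CyclicModel p U W α β γ δ κ r s ω μ) {ε : ℂ}
    (hε : ε = α ∨ ε = β ∨ ε = γ ∨ ε = δ) {P Q e : Place K} (he : e.Residue U ε)
    (hP : P.Residue U r) (hPW : P.Residue W ω) (hQ : Q.Residue U s) (hQW : Q.Residue W ω) :
    p • (sumSubTwo P Q e : Place K →₀ ℤ) ∈ principalDivisors K := by
  classical
  have hU := M.transcendental
  have h1 := pow_ne_zero p M.sub_ne_zero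
  have h2 := sub_const_ne_zero hU γ
  have h3 := sub_const_ne_zero hU δ
  have h4 := pow_ne_zero 2 (sub_const_ne_zero hU ε)
  have h12 := mul_ne_zero h1 h2
  have h123 := mul_ne_zero h12 h3
  -- The function is $(W-\omega)^p(U-\gamma)(U-\delta)/(U-\varepsilon)^2$. Numerator and denominator
  -- are both of degree two in the poles of `U`, so these contributions cancel.
  refine ⟨_, mul_ne_zero h123 (inv_ne_zero h4), fun v => ?_⟩
  rw [← v.order_eq_iff (mul_ne_zero h123 (inv_ne_zero h4)), v.order_mul h123 (inv_ne_zero h4),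
    v.order_inv, v.order_mul h12 h3, v.order_mul h1 h2, v.order_pow M.sub_ne_zero,
    v.order_pow (sub_const_ne_zero hU ε), M.order_fiber hP hPW hQ hQW,
    M.order_sub_branch hε he]
  simp only [sumSubTwo, Finsupp.smul_apply, Finsupp.sub_apply, Finsupp.add_apply,
    Finsupp.single_apply, nsmul_eq_mul, @eq_comm _ v]
  push_cast
  ring

end CyclicModel

end CyclicModel

/-! ### Change of coordinate on the $u$-line, and the two cyclic models. -/

section Moebius

variable {K : Type} [Field K] [Algebra ℂ K]

theorem inv_sub_not_mem_range {u : K} (hu : u ∉ Set.range (algebraMap ℂ K)) (m : ℂ) :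
    (u - algebraMap ℂ K m)⁻¹ ∉ Set.range (algebraMap ℂ K) := by
  rintro ⟨c, hc⟩
  exact hu ⟨c⁻¹ + m, by rw [map_add, map_inv₀, hc, inv_inv, sub_add_cancel]⟩

/-- Under $U=1/(u-m)$ a linear form in $U$ is a constant times the linear form in $u$ with the
corresponding zero, times $T=U$. As each side of a model relation has two such factors, $T^2$
cancels in `relation_transform`. -/
theorem inv_sub_sub_inv {u : K} (hu : u ∉ Set.range (algebraMap ℂ K)) {m c : ℂ} (hc : c ≠ m) :
    (u - algebraMap ℂ K m)⁻¹ - algebraMap ℂ K (c - m)⁻¹ =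
      algebraMap ℂ K (-(c - m)⁻¹) * ((u - algebraMap ℂ K c) * (u - algebraMap ℂ K m)⁻¹) := by
  have h1 := sub_const_ne_zero hu m
  have h2 : algebraMap ℂ K (c - m) ≠ 0 := (_root_.map_ne_zero _).2 (sub_ne_zero.2 hc)
  rw [map_neg, map_inv₀]
  field_simp
  rw [map_sub]
  ring

/-- Change of coordinate in a relation between products of linear forms. -/
theorem relation_transform {X T A B C D A' B' C' D' : K} {k a b c d : ℂ}
    (ha : a ≠ 0) (hb : b ≠ 0)
    (hA : A' = algebraMap ℂ K a * (A * T)) (hB : B' = algebraMap ℂ K b * (B * T))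
    (hC : C' = algebraMap ℂ K c * (C * T)) (hD : D' = algebraMap ℂ K d * (D * T))
    (h : X * (C * D) = algebraMap ℂ K k * (A * B)) :
    X * (C' * D') = algebraMap ℂ K (k * c * d / (a * b)) * (A' * B') := by
  have ha' : algebraMap ℂ K a ≠ 0 := (_root_.map_ne_zero _).2 ha
  have hb' : algebraMap ℂ K b ≠ 0 := (_root_.map_ne_zero _).2 hb
  rw [hA, hB, hC, hD]
  simp only [map_div₀, map_mul]
  field_simp
  linear_combination algebraMap ℂ K c * algebraMap ℂ K d * T ^ 2 * h

theorem adjoin_inv_sub {u w : K} (h : IntermediateField.adjoin ℂ {u, w} = ⊤) (m : ℂ) :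
    IntermediateField.adjoin ℂ {(u - algebraMap ℂ K m)⁻¹, w} = ⊤ := by
  rw [← top_le_iff, ← h, IntermediateField.adjoin_le_iff]
  rintro f (rfl | rfl)
  · have h1 : (f - algebraMap ℂ K m)⁻¹ ∈
        IntermediateField.adjoin ℂ {(f - algebraMap ℂ K m)⁻¹, w} :=
      IntermediateField.subset_adjoin ℂ _ (by simp)
    have h2 := add_mem (inv_mem h1)
      (IntermediateField.algebraMap_mem (IntermediateField.adjoin ℂ _) m)
    rwa [inv_inv, sub_add_cancel] at h2
  · exact IntermediateField.subset_adjoin ℂ _ (by simp)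

theorem inv_sub_inj {m c d : ℂ} (h : c ≠ d) : (c - m)⁻¹ ≠ (d - m)⁻¹ := fun h' =>
  h (sub_left_injective (inv_injective h'))

theorem exists_ne_five (a b c d e : ℂ) : ∃ m : ℂ, a ≠ m ∧ b ≠ m ∧ c ≠ m ∧ d ≠ m ∧ e ≠ m := by
  obtain ⟨m, hm⟩ := Infinite.exists_notMem_finset ({a, b, c, d, e} : Finset ℂ)
  simp only [Finset.mem_insert, Finset.mem_singleton, not_or] at hm
  exact ⟨m, Ne.symm hm.1, Ne.symm hm.2.1, Ne.symm hm.2.2.1, Ne.symm hm.2.2.2.1,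
    Ne.symm hm.2.2.2.2⟩

/-- A place lies over one of the points `0, 1, 1 / λ, ∞` of the `u`-line. -/
def Place.IsBranch (v : Place K) (l : ℂ) (u : K) : Prop :=
  v.Residue u 0 ∨ v.Residue u 1 ∨ v.Residue u l⁻¹ ∨ v.Residue u⁻¹ 0

theorem Place.Residue.inv_sub {v : Place K} {u : K} {c m : ℂ} (h : v.Residue u c) (hc : c ≠ m) :
    v.Residue (u - algebraMap ℂ K m)⁻¹ (c - m)⁻¹ :=
  (h.sub (.const v m)).inv (sub_ne_zero.2 hc)

/-- Written as $u^{-1}/(1-mu^{-1})$, the new coordinate visibly vanishes at $u=\infty$. -/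
theorem Place.Residue.inv_sub_of_inv {v : Place K} {u : K} (hu : u ∉ Set.range (algebraMap ℂ K))
    {m : ℂ} (h : v.Residue u⁻¹ 0) : v.Residue (u - algebraMap ℂ K m)⁻¹ 0 := by
  have h1 : (u - algebraMap ℂ K m)⁻¹ = u⁻¹ / (1 - algebraMap ℂ K m * u⁻¹) := by
    have h2 := ne_zero_of_not_mem_range hu
    have h3 : 1 - algebraMap ℂ K m * u⁻¹ = (u - algebraMap ℂ K m) * u⁻¹ := by
      field_simp
    rw [h3]
    have := sub_const_ne_zero hu m
    field_simp
  rw [h1]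
  simpa using h.div ((Place.Residue.one v).sub ((Place.Residue.const v m).mul h)) (by simp)

theorem Place.IsBranch.residue {v : Place K} {l m : ℂ} {u : K} (h : v.IsBranch l u)
    (hu : u ∉ Set.range (algebraMap ℂ K)) (h0 : 0 ≠ m) (h1 : 1 ≠ m) (hl : l⁻¹ ≠ m) :
    ∃ ε : ℂ, (ε = (0 - m)⁻¹ ∨ ε = (1 - m)⁻¹ ∨ ε = (l⁻¹ - m)⁻¹ ∨ ε = 0) ∧
      v.Residue (u - algebraMap ℂ K m)⁻¹ ε := by
  rcases h with h | h | h | h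
  · exact ⟨_, Or.inl rfl, h.inv_sub h0⟩
  · exact ⟨_, Or.inr (Or.inl rfl), h.inv_sub h1⟩
  · exact ⟨_, Or.inr (Or.inr (Or.inl rfl)), h.inv_sub hl⟩
  · exact ⟨_, Or.inr (Or.inr (Or.inr rfl)), h.inv_sub_of_inv hu⟩

variable {p : ℕ} {u w : K} {l r s ω : ℂ}

/-- By Vieta $r,s$ are the roots of $\lambda z^2-2z+1$, whose values $1$ at $0$ and $1-1/\lambda$ at
$1/\lambda$ are non-zero. So the fibre avoids these possible poles of $w$. -/
theorem ne_of_fiber (hl0 : l ≠ 0) (hl1 : l ≠ 1) (hsum : l * (r + s) = 2) (hprod : l * (r * s) = 1) :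
    r ≠ 0 ∧ r ≠ l⁻¹ ∧ s ≠ 0 ∧ s ≠ l⁻¹ := by
  refine ⟨?_, ?_, ?_, ?_⟩
  · rintro rfl; simp at hprod
  · rintro rfl
    have h1 : s = 1 := by field_simp at hprod; exact hprod
    rw [h1] at hsum
    field_simp at hsum
    exact hl1 (by linear_combination hsum)
  · rintro rfl; simp at hprod
  · rintro rfl
    have h1 : r = 1 := by field_simp at hprod; exact hprod
    rw [h1] at hsum
    field_simp at hsum
    exact hl1 (by linear_combination hsum)

theorem map_fiber (hsum : l * (r + s) = 2) (hprod : l * (r * s) = 1) :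
    algebraMap ℂ K (-l) * ((u - algebraMap ℂ K r) * (u - algebraMap ℂ K s)) =
      2 * u - 1 - algebraMap ℂ K l * u ^ 2 := by
  have h1 := congrArg (algebraMap ℂ K) hsum
  have h2 := congrArg (algebraMap ℂ K) hprod
  simp only [map_mul, map_add, map_one, map_ofNat] at h1 h2
  rw [map_neg]
  linear_combination u * h1 - h2

/-- Here $w^p$ has zeros at $u=1,1/\lambda$ and poles at $u=0,\infty$. The condition
$\omega^p=\lambda-1$ makes $2u-1-\lambda u^2$ the numerator of $w^p-\omega^p$. -/
theorem nsmul_mem_principalDivisors_of_eq_one (hp : p ≠ 0)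
    (hu : u ∉ Set.range (algebraMap ℂ K)) (hgen : IntermediateField.adjoin ℂ {u, w} = ⊤)
    (hl0 : l ≠ 0) (hl1 : l ≠ 1) (hsum : l * (r + s) = 2) (hprod : l * (r * s) = 1) (hrs : r ≠ s)
    (hω : ω ^ p = l - 1) (hrel : w ^ p * u = -((1 - u) * (1 - algebraMap ℂ K l * u)))
    {P Q e : Place K} (he : e.IsBranch l u) (hP : P.Residue u r) (hPw : P.Residue w ω)
    (hQ : Q.Residue u s) (hQw : Q.Residue w ω) :
    p • (sumSubTwo P Q e : Place K →₀ ℤ) ∈ principalDivisors K := by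
  -- The point `m` sent to infinity must avoid the finite branch points and both points of the
  -- fibre, so that all of them stay finite.
  obtain ⟨m, hm0, hm1, hml, hmr, hms⟩ := exists_ne_five 0 1 l⁻¹ r s
  obtain ⟨hr0, hrl, hs0, hsl⟩ := ne_of_fiber hl0 hl1 hsum hprod
  have hlK : algebraMap ℂ K l ≠ 0 := (_root_.map_ne_zero _).2 hl0
  have hne : ∀ {c : ℂ}, c ≠ m → -(c - m)⁻¹ ≠ 0 := fun h =>
    neg_ne_zero.2 (inv_ne_zero (sub_ne_zero.2 h))
  have hne' : ∀ {c : ℂ}, c ≠ m → (c - m)⁻¹ ≠ 0 := fun h => inv_ne_zero (sub_ne_zero.2 h)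
  set U := (u - algebraMap ℂ K m)⁻¹ with hU
  -- The point $u=\infty$ goes to $U=0$; its linear form in $u$ is the constant $1$, which
  -- homogenizes the relation to two factors on each side.
  have hinf : U - algebraMap ℂ K 0 = algebraMap ℂ K 1 * (1 * U) := by simp
  have hω0 : ω ≠ 0 := by
    rintro rfl
    rw [zero_pow hp] at hω
    exact hl1 (by linear_combination -hω)
  have hωK : algebraMap ℂ K ω ^ p = algebraMap ℂ K l - 1 := by
    rw [← map_pow, hω, map_sub, map_one]
  have M : CyclicModel p U w (1 - m)⁻¹ (l⁻¹ - m)⁻¹ (0 - m)⁻¹ 0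
      (-l * -(0 - m)⁻¹ * 1 / (-(1 - m)⁻¹ * -(l⁻¹ - m)⁻¹)) (r - m)⁻¹ (s - m)⁻¹ ω
      (-l * -(0 - m)⁻¹ * 1 / (-(r - m)⁻¹ * -(s - m)⁻¹)) :=
    { exponent_ne_zero := hp
      transcendental := inv_sub_not_mem_range hu m
      generates := adjoin_inv_sub hgen m
      leading_ne_zero := div_ne_zero (mul_ne_zero (mul_ne_zero (neg_ne_zero.2 hl0) (hne hm0))
        one_ne_zero) (mul_ne_zero (hne hm1) (hne hml))
      relation := relation_transform (hne hm1) (hne hml) (inv_sub_sub_inv hu hm1)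
        (inv_sub_sub_inv hu hml) (inv_sub_sub_inv hu hm0) hinf (by
          rw [map_zero, map_one, map_neg, map_inv₀]
          field_simp
          linear_combination hrel)
      ne_αβ := inv_sub_inj (by simpa [eq_comm] using hl1)
      ne_αγ := inv_sub_inj one_ne_zero
      ne_αδ := hne' hm1
      ne_βγ := inv_sub_inj (inv_ne_zero hl0)
      ne_βδ := hne' hml
      ne_γδ := hne' hm0
      value_ne_zero := hω0
      fiber_leading_ne_zero := div_ne_zero (mul_ne_zero (mul_ne_zero (neg_ne_zero.2 hl0) (hne hm0))
        one_ne_zero) (mul_ne_zero (hne hmr) (hne hms))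
      fiber := relation_transform (hne hmr) (hne hms) (inv_sub_sub_inv hu hmr)
        (inv_sub_sub_inv hu hms) (inv_sub_sub_inv hu hm0) hinf (by
          rw [map_fiber hsum hprod, hωK, map_zero]
          linear_combination hrel)
      ne_rs := inv_sub_inj hrs
      ne_rγ := inv_sub_inj hr0
      ne_rδ := hne' hmr
      ne_sγ := inv_sub_inj hs0
      ne_sδ := hne' hms }
  obtain ⟨ε, hε, heU⟩ := he.residue hu hm0 hm1 hml
  exact M.nsmul_mem_principalDivisors (by tauto) heU (hP.inv_sub hmr) hPw (hQ.inv_sub hms) hQw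

/-- Here $w^p$ has zeros at $u=1,\infty$ and poles at $u=0,1/\lambda$, and $\omega=-1$. Since $p$ is
odd, $w^p-\omega^p=w^p+1$, with the same numerator $2u-1-\lambda u^2$ as in the other case. -/
theorem nsmul_mem_principalDivisors_of_eq_sub_one (hp : Odd p)
    (hu : u ∉ Set.range (algebraMap ℂ K)) (hgen : IntermediateField.adjoin ℂ {u, w} = ⊤)
    (hl0 : l ≠ 0) (hl1 : l ≠ 1) (hsum : l * (r + s) = 2) (hprod : l * (r * s) = 1) (hrs : r ≠ s)
    (hrel : w ^ p * (u * (1 - algebraMap ℂ K l * u)) = u - 1)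
    {P Q e : Place K} (he : e.IsBranch l u) (hP : P.Residue u r) (hPw : P.Residue w (-1))
    (hQ : Q.Residue u s) (hQw : Q.Residue w (-1)) :
    p • (sumSubTwo P Q e : Place K →₀ ℤ) ∈ principalDivisors K := by
  obtain ⟨m, hm0, hm1, hml, hmr, hms⟩ := exists_ne_five 0 1 l⁻¹ r s
  obtain ⟨hr0, hrl, hs0, hsl⟩ := ne_of_fiber hl0 hl1 hsum hprod
  have hlK : algebraMap ℂ K l ≠ 0 := (_root_.map_ne_zero _).2 hl0
  have hne : ∀ {c : ℂ}, c ≠ m → -(c - m)⁻¹ ≠ 0 := fun h =>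
    neg_ne_zero.2 (inv_ne_zero (sub_ne_zero.2 h))
  have hne' : ∀ {c : ℂ}, c ≠ m → (c - m)⁻¹ ≠ 0 := fun h => inv_ne_zero (sub_ne_zero.2 h)
  set U := (u - algebraMap ℂ K m)⁻¹ with hU
  have hinf : U - algebraMap ℂ K 0 = algebraMap ℂ K 1 * (1 * U) := by simp
  have M : CyclicModel p U w (1 - m)⁻¹ 0 (0 - m)⁻¹ (l⁻¹ - m)⁻¹
      (-l⁻¹ * -(0 - m)⁻¹ * -(l⁻¹ - m)⁻¹ / (-(1 - m)⁻¹ * 1)) (r - m)⁻¹ (s - m)⁻¹ (-1)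
      (1 * -(0 - m)⁻¹ * -(l⁻¹ - m)⁻¹ / (-(r - m)⁻¹ * -(s - m)⁻¹)) :=
    { exponent_ne_zero := hp.pos.ne'
      transcendental := inv_sub_not_mem_range hu m
      generates := adjoin_inv_sub hgen m
      leading_ne_zero := div_ne_zero (mul_ne_zero (mul_ne_zero (neg_ne_zero.2 (inv_ne_zero hl0))
        (hne hm0)) (hne hml)) (mul_ne_zero (hne hm1) one_ne_zero)
      relation := relation_transform (hne hm1) one_ne_zero (inv_sub_sub_inv hu hm1)
        hinf (inv_sub_sub_inv hu hm0) (inv_sub_sub_inv hu hml) (by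
          rw [map_zero, map_one, map_neg, map_inv₀]
          field_simp
          linear_combination -hrel)
      ne_αβ := hne' hm1
      ne_αγ := inv_sub_inj one_ne_zero
      ne_αδ := inv_sub_inj (by simpa [eq_comm] using hl1)
      ne_βγ := (hne' hm0).symm
      ne_βδ := (hne' hml).symm
      ne_γδ := inv_sub_inj (inv_ne_zero hl0).symm
      value_ne_zero := by norm_num
      fiber_leading_ne_zero := div_ne_zero (mul_ne_zero (mul_ne_zero one_ne_zero (hne hm0))
        (hne hml)) (mul_ne_zero (hne hmr) (hne hms))
      fiber := relation_transform (hne hmr) (hne hms) (inv_sub_sub_inv hu hmr)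
        (inv_sub_sub_inv hu hms) (inv_sub_sub_inv hu hm0) (inv_sub_sub_inv hu hml) (by
          have h1 := map_fiber (K := K) (u := u) hsum hprod
          -- The denominator is now monic, $u(u-1/\lambda)$; multiplying by $-\lambda$ restores
          -- $u(1-\lambda u)$ and the numerator supplied by `map_fiber`.
          apply mul_left_cancel₀ (neg_ne_zero.2 hlK)
          rw [map_neg] at h1
          rw [map_one, one_mul, h1, map_neg, map_one, hp.neg_one_pow, map_zero, map_inv₀]
          field_simp
          linear_combination hrel)
      ne_rs := inv_sub_inj hrs
      ne_rγ := inv_sub_inj hr0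
      ne_rδ := inv_sub_inj hrl
      ne_sγ := inv_sub_inj hs0
      ne_sδ := inv_sub_inj hsl }
  obtain ⟨ε, hε, heU⟩ := he.residue hu hm0 hm1 hml
  exact M.nsmul_mem_principalDivisors (by tauto) heU (hP.inv_sub hmr) hPw (hQ.inv_sub hms) hQw

end Moebius

/-! ### Values of the coordinate functions at points of $X$, and generators of the function field of
$C$. -/

section Residues

variable {K : Type} [Field K] [Algebra ℂ K]

theorem Place.HasValue.residue {v : Place K} {f : K} {z : P1} (h : v.HasValue f z)
    (hz : z.rep 1 ≠ 0) : v.Residue f (z.rep 0 / z.rep 1) := by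
  rw [Place.HasValue, HasValueAt] at h
  have hz' : algebraMap ℂ K (z.rep 1) ≠ 0 := (_root_.map_ne_zero _).2 hz
  have e : algebraMap ℂ K (z.rep 1) * f - algebraMap ℂ K (z.rep 0) =
      algebraMap ℂ K (z.rep 1) * (f - algebraMap ℂ K (z.rep 0 / z.rep 1)) := by
    rw [map_div₀]
    field_simp
  rw [e, AddValuation.map_mul, v.ord_algebraMap _ hz, zero_add] at h
  rw [Place.Residue]
  rcases le_or_gt 0 (v.ord f) with hf | hf
  · rwa [min_eq_left hf] at h
  · have h1 := lt_of_lt_of_le hf (v.ord_algebraMap_nonneg (z.rep 0 / z.rep 1))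
    rw [AddValuation.map_sub_eq_of_lt_left v.ord h1, min_eq_right hf.le] at h
    exact absurd h (lt_irrefl _)

theorem Place.HasValue.residue_inv {v : Place K} {f : K} {z : P1} (h : v.HasValue f z)
    (hz : z.rep 1 = 0) : v.Residue f⁻¹ 0 := by
  have hz0 : z.rep 0 ≠ 0 := (rep_ne z).resolve_right (not_not.2 hz)
  rw [Place.HasValue, HasValueAt, hz, map_zero, zero_mul, zero_sub, AddValuation.map_neg,
    v.ord_algebraMap _ hz0, min_lt_iff] at h
  have hf := h.resolve_left (lt_irrefl _)
  have hf0 : f ≠ 0 := by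
    rintro rfl
    rw [AddValuation.map_zero] at hf
    exact absurd hf (not_lt.2 le_top)
  rw [v.residue_zero_iff (inv_ne_zero hf0), v.order_inv]
  rw [← v.coe_order hf0, ← WithTop.coe_zero, WithTop.coe_lt_coe] at hf
  omega

theorem Place.HasValue.residue_affine {v : Place K} {f : K} {s : ℂ} (h : v.HasValue f (affine s)) :
    v.Residue f s := by
  obtain ⟨c, hc, h0, h1⟩ := affine_rep s
  have h2 := h.residue (h1 ▸ hc)
  rwa [h0, h1, mul_div_cancel_left₀ _ hc] at h2

end Residues

variable {p : ℕ} [hp : Fact p.Prime] {l : Parameter}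

/-- The image point is a choice among places below `q`; this property is all that the argument uses
about it. -/
theorem phi_spec (a b : Exponent p) (q : Curve p l) : ∃ v : Place (CurveField p l),
    v.CenteredAt q ∧ v.LiesOver (pullback p l a b) (phi p l a b q) :=
  (exists_image a b q).choose_spec

theorem CurveField.y_ne_zero : CurveField.y p l ≠ 0 := by
  intro h
  have h1 := CurveField.equation p l
  rw [h, zero_pow hp.out.ne_zero, sub_zero, mul_one, mul_zero] at h1
  exact one_sub_x_pow_ne_zero p l h1

namespace QuotientField

variable {a b : Exponent p}

theorem u_not_mem_range : u p l a b ∉ Set.range (algebraMap ℂ (QuotientField p l a b)) := by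
  rintro ⟨c, hc⟩
  have h : AdjoinRoot.of (quotientPoly p l a b) (RatFunc.C c) = AdjoinRoot.of _ RatFunc.X := hc
  have h1 := (AdjoinRoot.of (quotientPoly p l a b)).injective h
  rw [← RatFunc.algebraMap_C, ← RatFunc.algebraMap_X] at h1
  exact X_ne_C c (RatFunc.algebraMap_injective ℂ h1).symm

theorem equation : v p l a b ^ p = (-u p l a b) ^ (a : ℕ) * (1 - u p l a b) ^ (p - a) *
    (1 - algebraMap ℂ (QuotientField p l a b) l * u p l a b) ^ (p - b) := by
  have h := AdjoinRoot.eval₂_root (quotientPoly p l a b)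
  rw [quotientPoly, eval₂_sub, eval₂_pow, eval₂_X, eval₂_C, sub_eq_zero] at h
  simp only [map_mul, map_pow, map_neg, map_sub, map_one] at h
  exact h

theorem equation_of {i j k : ℕ} (hi : (a : ℕ) = i) (hj : p - (a : ℕ) = j) (hk : p - (b : ℕ) = k) :
    v p l a b ^ p = (-u p l a b) ^ i * (1 - u p l a b) ^ j *
      (1 - algebraMap ℂ (QuotientField p l a b) l * u p l a b) ^ k := by
  subst hi hj hk
  exact equation

theorem one_sub_u_ne_zero : 1 - u p l a b ≠ 0 := fun h =>
  u_not_mem_range (l := l) (a := a) (b := b) ⟨1, by rw [map_one]; exact sub_eq_zero.1 h⟩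

theorem one_sub_mul_u_ne_zero :
    1 - algebraMap ℂ (QuotientField p l a b) l * u p l a b ≠ 0 := by
  intro h
  have hl : algebraMap ℂ (QuotientField p l a b) l ≠ 0 := (_root_.map_ne_zero _).2 l.2.1
  refine u_not_mem_range (l := l) (a := a) (b := b) ⟨(l : ℂ)⁻¹, ?_⟩
  rw [map_inv₀]
  exact inv_eq_of_mul_eq_one_right (sub_eq_zero.1 h).symm

theorem adjoin_eq_top : IntermediateField.adjoin ℂ {u p l a b, v p l a b} = ⊤ := by
  set F := IntermediateField.adjoin ℂ {u p l a b, v p l a b} with hF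
  have hu : u p l a b ∈ F := IntermediateField.subset_adjoin ℂ _ (by simp)
  have hv : v p l a b ∈ F := IntermediateField.subset_adjoin ℂ _ (by simp)
  have hpoly : ∀ g : ℂ[X], AdjoinRoot.of (quotientPoly p l a b) (algebraMap ℂ[X] _ g) ∈ F := by
    intro g
    induction g using Polynomial.induction_on' with
    | add g h hg hh => rw [map_add, map_add]; exact add_mem hg hh
    | monomial n c =>
      rw [← C_mul_X_pow_eq_monomial, map_mul, map_mul, map_pow, map_pow, RatFunc.algebraMap_X,
        RatFunc.algebraMap_C]
      exact mul_mem (F.algebraMap_mem c) (pow_mem hu n)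
  rw [← top_le_iff]
  intro f _
  induction f using AdjoinRoot.induction_on with
  | ih g =>
    induction g using Polynomial.induction_on' with
    | add g h hg hh => rw [map_add]; exact add_mem (hg trivial) (hh trivial)
    | monomial n c =>
      rw [← C_mul_X_pow_eq_monomial, map_mul, map_pow, AdjoinRoot.mk_C, AdjoinRoot.mk_X,
        ← RatFunc.num_div_denom c, map_div₀]
      exact mul_mem (div_mem (hpoly _) (hpoly _)) (pow_mem hv n)

/-- As $v=f/(f/v)$ with $f$ rational in $u$, the double covering function $w=f/v$ can replace $v$ as
a generator. -/
theorem adjoin_div_v_eq_top {f : QuotientField p l a b} (hf0 : f ≠ 0)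
    (hf : f ∈ IntermediateField.adjoin ℂ {u p l a b}) :
    IntermediateField.adjoin ℂ {u p l a b, f / v p l a b} = ⊤ := by
  rw [← top_le_iff, ← adjoin_eq_top, IntermediateField.adjoin_le_iff]
  rintro g (rfl | rfl)
  · exact IntermediateField.subset_adjoin ℂ _ (by simp)
  · have h1 : f / v p l a b ∈ IntermediateField.adjoin ℂ {u p l a b, f / v p l a b} :=
      IntermediateField.subset_adjoin ℂ _ (by simp)
    have h2 : f ∈ IntermediateField.adjoin ℂ {u p l a b, f / v p l a b} :=
      IntermediateField.adjoin.mono ℂ _ _ (by simp) hf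
    have h3 := div_mem h2 h1
    rwa [div_div_cancel₀ hf0] at h3

end QuotientField

/-! ### Images of the cusps and of affine points of $X$. -/

open QuotientField in
/-- The cusps of `X_{p,λ}` lie over the points `0, 1, 1 / λ, ∞` of the `u`-line. -/
theorem phi_isBranch (a b : Exponent p) {e : Curve p l} (he : e.IsCusp) :
    (phi p l a b e).IsBranch l (u p l a b) := by
  obtain ⟨v, ⟨hx, hy⟩, hv⟩ := phi_spec a b e
  have hp0 := hp.out.ne_zero
  have hl0 := l.2.1
  have hlK : algebraMap ℂ (CurveField p l) l ≠ 0 := (_root_.map_ne_zero _).2 hl0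
  have hpu := pullback_u p l a b
  have h1x := one_sub_x_pow_ne_zero p l
  have heq := CurveField.equation p l
  have hx0 := ne_zero_of_not_mem_range (CurveField.x_not_mem_range p l)
  have hy0 := CurveField.y_ne_zero (p := p) (l := l)
  set x := CurveField.x p l
  set y := CurveField.y p l
  have hxp := pow_ne_zero p hx0
  have hyp := pow_ne_zero p hy0
  -- The curve equation says $1-\lambda u=y^{-p}$, which makes $u$ readable where $y$ is $0$ or
  -- $\infty$.
  have hpu' : pullback p l a b (u p l a b) = algebraMap ℂ _ (l : ℂ)⁻¹ * (1 - (y⁻¹) ^ p) := by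
    rw [hpu, map_inv₀, inv_pow]
    field_simp
    linear_combination heq
  rw [Curve.IsCusp, mul_eq_zero, mul_eq_zero, mul_eq_zero] at he
  -- The cusps with $x=0$, $x=\infty$, $y=0$, $y=\infty$ lie over $u=0$, $1$, $\infty$, $1/\lambda$
  -- respectively.
  rcases he with ((he | he) | he) | he
  · left
    apply Place.Residue.of_liesOver hv
    have h1 := hx.residue ((rep_ne _).resolve_left (not_not.2 he))
    rw [he, zero_div] at h1
    rw [hpu]
    simpa [hp0] using (h1.pow p).neg.div ((Place.Residue.one v).sub (h1.pow p)) (by simp [hp0])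
  · right; left
    apply Place.Residue.of_liesOver hv
    have h1 := hx.residue_inv he
    have h2 : pullback p l a b (u p l a b) = (1 - (x⁻¹) ^ p)⁻¹ := by
      rw [hpu, inv_pow]
      have h3 : 1 - (x ^ p)⁻¹ = -(1 - x ^ p) / x ^ p := by field_simp; ring
      rw [h3, inv_div, div_neg, neg_div]
    rw [h2]
    simpa [hp0] using ((Place.Residue.one v).sub (h1.pow p)).inv (by simp [hp0])
  · right; right; right
    apply Place.Residue.of_liesOver hv
    have h1 := hy.residue ((rep_ne _).resolve_left (not_not.2 he))
    rw [he, zero_div] at h1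
    have h2 : pullback p l a b (u p l a b)⁻¹ = algebraMap ℂ _ (l : ℂ) * y ^ p / (y ^ p - 1) := by
      have h3 : 1 - (y ^ p)⁻¹ = (y ^ p - 1) / y ^ p := by field_simp
      rw [map_inv₀, hpu', inv_pow, h3, mul_inv, inv_div, map_inv₀, inv_inv, mul_div_assoc]
    rw [h2]
    simpa [hp0] using ((Place.Residue.const v (l : ℂ)).mul (h1.pow p)).div
      ((h1.pow p).sub (.one v)) (by simp [hp0])
  · right; right; left
    apply Place.Residue.of_liesOver hv
    have h1 := hy.residue_inv he
    rw [hpu']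
    simpa [hp0] using (Place.Residue.const v (l : ℂ)⁻¹).mul ((Place.Residue.one v).sub (h1.pow p))

open QuotientField in
-- Values descend along `pullback`. The second clause reduces any value at the image point to a
-- computation in $x,y$ at an arbitrary place of $X$ with those coordinates.
theorem residue_phi_affinePoint (a b : Exponent p) {s t : ℂ}
    (h : (1 - s ^ p) * (1 - t ^ p) = l * s ^ p * t ^ p) (hs : 1 - s ^ p ≠ 0) :
    (phi p l a b (.affinePoint s t h)).Residue (u p l a b) (-s ^ p / (1 - s ^ p)) ∧
      ∀ f : QuotientField p l a b, ∀ c : ℂ, (∀ v : Place (CurveField p l),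
        v.Residue (CurveField.x p l) s → v.Residue (CurveField.y p l) t →
          v.Residue (pullback p l a b f) c) →
        (phi p l a b (.affinePoint s t h)).Residue f c := by
  obtain ⟨v, ⟨hx, hy⟩, hv⟩ := phi_spec a b (.affinePoint s t h)
  replace hx := Place.HasValue.residue_affine hx
  replace hy := Place.HasValue.residue_affine hy
  refine ⟨?_, fun f c hf => Place.Residue.of_liesOver hv (hf v hx hy)⟩
  apply Place.Residue.of_liesOver hv
  rw [pullback_u]
  exact (hx.pow p).neg.div ((Place.Residue.one v).sub (hx.pow p)) hs

/-! ### The double covering function $w$ in the two cases. -/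

open QuotientField in
-- The factors $1-u$ and $1-\lambda u$ pull back to $1/(1-x^p)$ and $1/y^p$, exactly the denominator
-- of $v$. The result is symmetric in $x,y$, hence equal at $P$ and $Q$.
theorem pullback_mul_of_eq_one {a b : Exponent p} (ha : (a : ℕ) = 1) (hb : (b : ℕ) = 1) :
    pullback p l a b ((1 - u p l a b) * (1 - algebraMap ℂ _ (l : ℂ) * u p l a b) / v p l a b) =
      (CurveField.x p l * CurveField.y p l)⁻¹ := by
  have h1x := one_sub_x_pow_ne_zero p l
  have heq := CurveField.equation p l
  have hx0 := ne_zero_of_not_mem_range (CurveField.x_not_mem_range p l)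
  have hy0 := CurveField.y_ne_zero (p := p) (l := l)
  simp only [map_div₀, map_mul, map_sub, map_one, AlgHom.commutes, pullback_u, pullback_v, ha, hb,
    pow_one]
  set x := CurveField.x p l
  set y := CurveField.y p l
  have e2 : 1 - -x ^ p / (1 - x ^ p) = 1 / (1 - x ^ p) := by field_simp; ring
  have e3 : 1 - algebraMap ℂ _ (l : ℂ) * (-x ^ p / (1 - x ^ p)) = 1 / y ^ p := by
    field_simp
    linear_combination -heq
  rw [e2, e3]
  field_simp

open QuotientField in
-- After $1/(1-x^p)$ cancels, $y^p/(x\,y^{p-1})$ remains. Its value is $-1$ wherever $y=-x\neq0$, in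
-- particular at $P$ and $Q$.
theorem pullback_div_of_eq_sub_one {a b : Exponent p} (ha : (a : ℕ) = 1) (hb : (b : ℕ) = p - 1) :
    pullback p l a b ((1 - u p l a b) / v p l a b) = CurveField.y p l / CurveField.x p l := by
  have h1x := one_sub_x_pow_ne_zero p l
  have hx0 := ne_zero_of_not_mem_range (CurveField.x_not_mem_range p l)
  have hy0 := CurveField.y_ne_zero (p := p) (l := l)
  simp only [map_div₀, map_sub, map_one, pullback_u, pullback_v, ha, hb, pow_one]
  set x := CurveField.x p l
  set y := CurveField.y p l
  have e2 : 1 - -x ^ p / (1 - x ^ p) = 1 / (1 - x ^ p) := by field_simp; ring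
  have e3 : y ^ p = y ^ (p - 1) * y := (pow_sub_one_mul hp.out.ne_zero y).symm
  rw [e2, e3]
  field_simp

open QuotientField in
theorem relation_of_eq_one {a b : Exponent p} (ha : (a : ℕ) = 1) (hb : (b : ℕ) = 1) :
    ((1 - u p l a b) * (1 - algebraMap ℂ _ (l : ℂ) * u p l a b) / v p l a b) ^ p * u p l a b =
      -((1 - u p l a b) * (1 - algebraMap ℂ _ (l : ℂ) * u p l a b)) := by
  have h1 := equation_of (l := l) ha (by rw [ha]) (by rw [hb])
  have hu := ne_zero_of_not_mem_range (u_not_mem_range (l := l) (a := a) (b := b))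
  have hu1 := one_sub_u_ne_zero (l := l) (a := a) (b := b)
  have hul := one_sub_mul_u_ne_zero (l := l) (a := a) (b := b)
  rw [pow_one] at h1
  rw [div_pow, h1, ← mul_pow_sub_one hp.out.ne_zero, mul_pow]
  set A := (1 - u p l a b) ^ (p - 1) with hA
  set B := (1 - algebraMap ℂ _ (l : ℂ) * u p l a b) ^ (p - 1) with hB
  have hA0 : A ≠ 0 := pow_ne_zero _ hu1
  have hB0 : B ≠ 0 := pow_ne_zero _ hul
  field_simp

open QuotientField in
theorem relation_of_eq_sub_one {a b : Exponent p} (ha : (a : ℕ) = 1) (hb : (b : ℕ) = p - 1) :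
    ((1 - u p l a b) / v p l a b) ^ p *
      (u p l a b * (1 - algebraMap ℂ _ (l : ℂ) * u p l a b)) = u p l a b - 1 := by
  have hpb : p - (p - 1) = 1 := by have := hp.out.one_lt; omega
  have h1 := equation_of (l := l) ha (by rw [ha]) (by rw [hb, hpb])
  have hu := ne_zero_of_not_mem_range (u_not_mem_range (l := l) (a := a) (b := b))
  have hu1 := one_sub_u_ne_zero (l := l) (a := a) (b := b)
  have hul := one_sub_mul_u_ne_zero (l := l) (a := a) (b := b)
  rw [pow_one, pow_one] at h1
  rw [div_pow, h1, ← mul_pow_sub_one hp.out.ne_zero]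
  set A := (1 - u p l a b) ^ (p - 1) with hA
  set B := 1 - algebraMap ℂ _ (l : ℂ) * u p l a b with hB
  have hA0 : A ≠ 0 := pow_ne_zero _ hu1
  field_simp
  ring

/-! ### Torsion in the Jacobian and the conclusion. -/

theorem pushforward_sumSubTwo {S T : Type} (f : S → T) (P Q e : S) :
    pushforward f (sumSubTwo P Q e) = sumSubTwo (f P) (f Q) (f e) := by
  apply Subtype.ext
  change Finsupp.mapDomain.addMonoidHom f
    (Finsupp.single P 1 + Finsupp.single Q 1 - 2 • Finsupp.single e 1 : S →₀ ℤ) = _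
  rw [map_sub, map_add, map_nsmul]
  simp [sumSubTwo, Finsupp.mapDomain_single]

theorem isOfFinAddOrder_of_nsmul_mem {K : Type} [Field K] [Algebra ℂ K] {n : ℕ} (hn : n ≠ 0)
    {D : DivZero (Place K)} (h : n • (D : Place K →₀ ℤ) ∈ principalDivisors K) :
    IsOfFinAddOrder (QuotientAddGroup.mk D : Jacobian K) := by
  rw [isOfFinAddOrder_iff_nsmul_eq_zero]
  refine ⟨n, Nat.pos_of_ne_zero hn, ?_⟩
  rw [← QuotientAddGroup.mk_nsmul, QuotientAddGroup.eq_zero_iff]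
  exact h

end
end HypergeometricCurve

open HypergeometricCurve HypergeometricCurve.QuotientField in
theorem proposition4p2 (p : ℕ) [hp : Fact p.Prime] (hp2 : p ≠ 2)
    (a b : HypergeometricCurve.Exponent p)
    (hab : ((a : ℕ), (b : ℕ)) = (1, 1) ∨ ((a : ℕ), (b : ℕ)) = (1, p - 1))
    (l : HypergeometricCurve.Parameter) (ρ ξ : ℂ) (hρ : ρ ^ p = 1 - l) (hξ : ξ ^ 2 = ρ⁻¹)
    (e : HypergeometricCurve.Curve p l) (he : e.IsCusp) :
    IsOfFinAddOrder
      (QuotientAddGroup.mk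
        (HypergeometricCurve.pushforward (HypergeometricCurve.phi p l a b)
          (HypergeometricCurve.sumSubTwo
            (HypergeometricCurve.Curve.fixedP (hp.out.odd_of_ne_two hp2) hρ hξ)
            (HypergeometricCurve.Curve.fixedQ (hp.out.odd_of_ne_two hp2) hρ hξ) e)) :
        HypergeometricCurve.Jacobian (HypergeometricCurve.QuotientField p l a b)) := by
  have hodd := hp.out.odd_of_ne_two hp2
  have hp0 := hp.out.ne_zero
  have hl0 := l.2.1
  have hl1 := l.2.2
  have hl : (1 : ℂ) - l ≠ 0 := sub_ne_zero.2 (Ne.symm hl1)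
  -- With $X=\xi^p$ this is the only relation needed: it excludes $X=\pm1$ because $\lambda\ne0$, so
  -- $u$ is finite at $P$ and $Q$.
  have hX : (ξ ^ p) ^ 2 * (1 - l) = 1 := by
    rw [pow_right_comm, hξ, inv_pow, hρ, inv_mul_cancel₀ hl]
  have hξ0 : ξ ≠ 0 := by
    rintro rfl
    simp [hp0] at hX
  have hX0 : ξ ^ p ≠ 0 := pow_ne_zero p hξ0
  have hP1 : 1 - ξ ^ p ≠ 0 := by
    intro h
    rw [← sub_eq_zero.1 h] at hX
    exact hl0 (by linear_combination -hX)
  have hneg : (-ξ) ^ p = -ξ ^ p := hodd.neg_pow ξ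
  have hQ1' : 1 + ξ ^ p ≠ 0 := by
    intro h
    have h1 : ξ ^ p = -1 := by linear_combination h
    rw [h1] at hX
    exact hl0 (by linear_combination -hX)
  have hQ1 : 1 - (-ξ) ^ p ≠ 0 := by rwa [hneg, sub_neg_eq_add]
  -- The values of $u$ at $P$ and $Q$ are $-X/(1-X)$ and $X/(1+X)$. This sum and the product below
  -- identify them as the roots of $\lambda z^2-2z+1$.
  have hsum : (l : ℂ) * (-ξ ^ p / (1 - ξ ^ p) + -(-ξ) ^ p / (1 - (-ξ) ^ p)) = 2 := by
    rw [hneg, sub_neg_eq_add]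
    field_simp
    linear_combination 2 * hX
  have hprod : (l : ℂ) * (-ξ ^ p / (1 - ξ ^ p) * (-(-ξ) ^ p / (1 - (-ξ) ^ p))) = 1 := by
    rw [hneg, sub_neg_eq_add]
    field_simp
    linear_combination hX
  have hrs : -ξ ^ p / (1 - ξ ^ p) ≠ -(-ξ) ^ p / (1 - (-ξ) ^ p) := by
    rw [hneg, sub_neg_eq_add, neg_neg, Ne, div_eq_div_iff hP1 hQ1']
    intro h
    exact hX0 (by linear_combination -h / 2)
  rw [pushforward_sumSubTwo]
  apply isOfFinAddOrder_of_nsmul_mem hp0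
  have hbr := phi_isBranch a b he
  obtain ⟨hP, hPw⟩ := residue_phi_affinePoint a b (fixedPoint_eq hodd hρ hξ) hP1
  obtain ⟨hQ, hQw⟩ := residue_phi_affinePoint (l := l) a b (s := -ξ) (t := ξ)
    (by linear_combination fixedPoint_eq hodd hρ hξ) hQ1
  have hu : u p l a b ∈ IntermediateField.adjoin ℂ {u p l a b} :=
    IntermediateField.mem_adjoin_simple_self ℂ _
  have h1u := sub_mem (one_mem _) hu
  have hu1 : 1 - u p l a b ≠ 0 := one_sub_u_ne_zero
  have hut := u_not_mem_range (l := l) (a := a) (b := b)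
  rcases hab with hab | hab
  · obtain ⟨ha, hb⟩ := Prod.mk.inj hab
    have hgen := adjoin_div_v_eq_top (mul_ne_zero hu1 one_sub_mul_u_ne_zero)
      (mul_mem h1u (sub_mem (one_mem _) (mul_mem (IntermediateField.algebraMap_mem _ (l : ℂ)) hu)))
    -- The constant is the common value of $1/(xy)$ at $P$ and $Q$, and its $p$-th power is
    -- $-X^{-2}=\lambda-1$.
    refine nsmul_mem_principalDivisors_of_eq_one (ω := (ξ * -ξ)⁻¹) hp0 hut hgen hl0 hl1
      hsum hprod hrs ?_ (relation_of_eq_one ha hb) hbr hP (hPw _ _ fun v hx hy => ?_) hQ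
      (hQw _ _ fun v hx hy => ?_)
    · rw [inv_pow, mul_pow, hneg]
      field_simp
      linear_combination hX
    · rw [pullback_mul_of_eq_one ha hb]
      exact (hx.mul hy).inv (by simpa using hξ0)
    · rw [pullback_mul_of_eq_one ha hb, mul_comm ξ]
      exact (hx.mul hy).inv (by simpa using hξ0)
  · obtain ⟨ha, hb⟩ := Prod.mk.inj hab
    have hgen := adjoin_div_v_eq_top hu1 h1u
    refine nsmul_mem_principalDivisors_of_eq_sub_one hodd hut hgen hl0 hl1
      hsum hprod hrs (relation_of_eq_sub_one ha hb) hbr hP (hPw _ _ fun v hx hy => ?_) hQ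
      (hQw _ _ fun v hx hy => ?_)
    · rw [pullback_div_of_eq_sub_one ha hb]
      convert hy.div hx hξ0 using 1
      field_simp
    · rw [pullback_div_of_eq_sub_one ha hb]
      convert hy.div hx (neg_ne_zero.2 hξ0) using 1
      field_simp
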